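/- Let $H\in(\tfrac12,1)$ and $T>0$, and let $B=\{B_t,\ t\ge 0\}$ be a one-dimensional fractional Brownian motion with Hurst parameter $H$, i.e. a centred Gaussian process with a.s. continuous paths and $\mathbb E(B_sB_t)=\frac12\left(t^{2H}+s^{2H}-|t-s|^{2H}\right)$. For $n\ge 1$ put $t_k=\frac{kT}{n}$, $k=0,\dots,n+1$, and let $\Pi=\{t_0,\dots,t_n\}$. For $t\in[t_l,t_{l+1})\cap[0,T]$, $l=0,\dots,n$, define $$z_n(t)=\sum_{k=0}^{l}\left(\int_{t_k}^{t_{k+1}}\int_{t_k}^{s}du\,dB_s-\int_{t_k}^{t_{k+1}}\int_{s}^{t_{k+1}}du\,dB_s\right),$$ where the integrals with respect to $B$ are pathwise Riemann–Stieltjes integrals. With $\mu(ds\,dt)=H(2H-1)|s-t|^{2H-2}\,ds\,dt$, put for $p\in\mathbb Z$ $$\widetilde Q(p)=\int_0^1\int_p^{p+1}\left(\int_0^t\int_p^s dv\,du\right)\mu(ds\,dt),\qquad \widetilde R(p)=\int_0^1\int_p^{p+1}\left(\int_t^1\int_p^s dv\,du\right)\mu(ds\,dt),$$ where $t$ ranges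 over $[0,1]$ and $s$ over $[p,p+1]$. Then: 1. The series $\varrho:=\sum_{p\in\mathbb Z}\left(\widetilde Q(p)-\widetilde R(p)\right)$ converges absolutely, and $\varrho\ge 0$. 2. There is a constant $K$ depending only on $H$ and $T$ such that, for all $n\ge1$ and all $s,t\in\Pi$, the increment $z_n(t)-z_n(s)$ is square integrable and $$n^{2H+1}\,\mathbb E\left([z_n(t)-z_n(s)]^2\right)\le K|t-s|.$$ 3. As $n\to\infty$, the finite-dimensional distributions of the process $\left(n^{H+\frac12}z_n(t),B_t\right)_{t\in[0,T]}$ converge weakly to those of $\left(\sqrt{2\varrho}\;T^{H+\frac12}W_t,B_t\right)_{t\in[0,T]}$, where $W=\{W_t\}$ is a standard Brownian motion independent of $B$ (possibly defined, together with a copy of $B$, on another probability space). -/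

import Mathlib

open MeasureTheory ProbabilityTheory Filter
open scoped NNReal Topology

/-- `X` is a fractional Brownian motion with Hurst parameter `H` on `(Ω, P)`: a centred Gaussian
process on `[0, ∞)` with `E[X_s X_t] = (t^{2H} + s^{2H} - |t - s|^{2H}) / 2` and almost surely
continuous paths. -/
structure IsFractionalBrownian {Ω : Type*} [MeasurableSpace Ω] (H : ℝ) (X : ℝ≥0 → Ω → ℝ)
    (P : Measure Ω) : Prop where
  isGaussianProcess : IsGaussianProcess X P
  mean_eq_zero : ∀ t, ∫ ω, X t ω ∂P = 0
  covariance_eq : ∀ s t, ∫ ω, X s ω * X t ω ∂P =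
    ((t : ℝ) ^ (2 * H) + (s : ℝ) ^ (2 * H) - |(t : ℝ) - (s : ℝ)| ^ (2 * H)) / 2
  continuous_paths : ∀ᵐ ω ∂P, Continuous fun t => X t ω

/-- `I` is the Riemann-Stieltjes integral `∫_a^b f dg`: the sums
`∑ f(ξ_i) (g(x_{i+1}) - g(x_i))` over partitions `a = x_0 ≤ ⋯ ≤ x_N = b` with arbitrary tags
`x_i ≤ ξ_i ≤ x_{i+1}` converge to `I` as the mesh tends to zero. -/
def HasRSIntegral (f g : ℝ≥0 → ℝ) (a b : ℝ≥0) (I : ℝ) : Prop :=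
  ∀ ε : ℝ, 0 < ε → ∃ δ : ℝ, 0 < δ ∧
    ∀ (N : ℕ) (x ξ : ℕ → ℝ≥0), x 0 = a → x N = b →
      (∀ i < N, x i ≤ ξ i ∧ ξ i ≤ x (i + 1) ∧ (x (i + 1) : ℝ) - (x i : ℝ) < δ) →
      |∑ i ∈ Finset.range N, f (ξ i) * (g (x (i + 1)) - g (x i)) - I| < ε

open Classical in
/-- The value of the Riemann-Stieltjes integral `∫_a^b f dg`, for `a ≤ b` (zero if it does not
exist). -/
noncomputable def rsIntegral (f g : ℝ≥0 → ℝ) (a b : ℝ≥0) : ℝ :=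
  if h : ∃ I, HasRSIntegral f g a b I then h.choose else 0

/-- The points `t_k = k T / n` of the uniform partition, for all `k` (so also `t_{n+1}`). -/
noncomputable def partitionPoint (T : ℝ≥0) (n k : ℕ) : ℝ≥0 := k * T / n

/-- The Lévy area type process of the paths `b` (for `B`) and `b'` (for the second process): for
`t ∈ [t_l, t_{l+1})`, that is `l = ⌊n t / T⌋`, the sum over `k = 0, …, l` of
`∫_{t_k}^{t_{k+1}} ∫_{t_k}^s db'_u db_s - ∫_{t_k}^{t_{k+1}} ∫_s^{t_{k+1}} db'_u db_s`. -/
noncomputable def levyArea (T : ℝ≥0) (n : ℕ) (b' b : ℝ≥0 → ℝ) (t : ℝ≥0) : ℝ :=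
  ∑ k ∈ Finset.range (⌊(n : ℝ≥0) * t / T⌋₊ + 1),
    (rsIntegral (fun s => rsIntegral (fun _ => 1) b' (partitionPoint T n k) s) b
        (partitionPoint T n k) (partitionPoint T n (k + 1)) -
      rsIntegral (fun s => rsIntegral (fun _ => 1) b' s (partitionPoint T n (k + 1))) b
        (partitionPoint T n k) (partitionPoint T n (k + 1)))

/-- The process `z_n`: the Lévy area type process of `X` and the identity function. -/
noncomputable def zArea {Ω : Type*} (T : ℝ≥0) (X : ℝ≥0 → Ω → ℝ) (n : ℕ) (t : ℝ≥0) (ω : Ω) : ℝ :=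
  levyArea T n (fun u => (u : ℝ)) (fun s => X s ω) t

/-- The density `H (2H - 1) |s - t|^{2H - 2}` of the measure `μ(ds dt)`. -/
noncomputable def muDensity (H s t : ℝ) : ℝ := H * (2 * H - 1) * |s - t| ^ (2 * H - 2)

/-- `Q(p) = ∫_0^1 ∫_p^{p+1} (∫_0^t ∫_p^s dv du) μ(ds dt)`. -/
noncomputable def tildeQ (H : ℝ) (p : ℤ) : ℝ :=
  ∫ t in (0 : ℝ)..1, ∫ s in (p : ℝ)..(p + 1),
    (∫ _u in (0 : ℝ)..t, ∫ _v in (p : ℝ)..s, (1 : ℝ)) * muDensity H s t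

/-- `R(p) = ∫_0^1 ∫_p^{p+1} (∫_t^1 ∫_p^s dv du) μ(ds dt)`. -/
noncomputable def tildeR (H : ℝ) (p : ℤ) : ℝ :=
  ∫ t in (0 : ℝ)..1, ∫ s in (p : ℝ)..(p + 1),
    (∫ _u in t..(1 : ℝ), ∫ _v in (p : ℝ)..s, (1 : ℝ)) * muDensity H s t

/-- `ϱ = ∑_{p ∈ ℤ} (Q(p) - R(p))`. -/
noncomputable def varrho (H : ℝ) : ℝ := ∑' p : ℤ, (tildeQ H p - tildeR H p)

/-! Everything reduces to one linear functional, `trapezoidError`: E(f) = f(0) + f(1) - 2∫₀¹ f. With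
h = T/n, integration by parts in the Riemann-Stieltjes integrals turns the k-th summand of z_n into
h·E(u ↦ B(h(k+u))). Hence z_n and B are jointly centred Gaussian, and weak convergence of the
finite-dimensional distributions amounts to convergence of covariances.

Write φ(x) = |x|^{2H}/2 (`halfPow`), so that E(B_s B_t) = φ(s) + φ(t) - φ(s - t). Since E kills
constants, only -φ(s - t) contributes to the covariance of the j-th and k-th summands, which is
h^{2H+2} γ(j - k) with γ = `areaCov`, obtained from -φ by applying E in both variables. Let τ(y) be
the error of φ on [y, y+1] (`trapPow`). Convexity of φ gives τ ≥ 0, and concavity of φ' on [0,∞)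
makes τ decreasing there; so |γ(m+1)| ≤ τ(m) - τ(m+1), which telescopes, and γ is even: γ is
summable (`summable_areaCov`).

Two integrations by parts give 2(Q(p) - R(p)) = γ(p) - (τ(p) - τ(p-1)) (`tildeQ_sub_tildeR`). The
correction is odd in p and summable, so ∑γ = 2ϱ. As ∑γ is a limit of normalised variances, ϱ ≥ 0.

Summing γ(j - k) over a square block costs at most its side times ∑|γ|, which is the second moment
bound. Over a rectangle with sides proportional to t and s the sum is asymptotically n·min(t,s)/T·∑γ
(`tendsto_sum_sum_sub`), the Brownian covariance. The covariance of z_n(t) with B_r telescopes to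
O(n⁻²) (`abs_sum_crossCov_le`), which beats n^{H+1/2}; hence the limit W is independent of B. -/

section
variable {H : ℝ}

/-! ### Calculus of the trapezoidal error -/

/-- The signed error `f 0 + f 1 - 2 ∫_0^1 f` of (twice) the trapezoidal rule on `[0, 1]`. -/
noncomputable def trapezoidError (f : ℝ → ℝ) : ℝ := f 0 + f 1 - 2 * ∫ u in (0 : ℝ)..1, f u

/-- The trapezoidal error of `f` on `[y, y + 1]`. -/
noncomputable def trapezoidShift (f : ℝ → ℝ) (y : ℝ) : ℝ := trapezoidError fun u => f (y + u)

/-- The mean of `f` on `[y, y + 1]`. -/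
noncomputable def unitMean (f : ℝ → ℝ) (y : ℝ) : ℝ := ∫ u in (0 : ℝ)..1, f (y + u)

lemma trapezoidError_reflect (f : ℝ → ℝ) :
    trapezoidError (fun u => f (1 - u)) = trapezoidError f := by
  have := intervalIntegral.integral_comp_sub_left (a := 0) (b := 1) f 1
  simp only [trapezoidError, this]
  simp [add_comm]

lemma trapezoidError_add {f g : ℝ → ℝ} (hf : Continuous f) (hg : Continuous g) :
    trapezoidError (fun u => f u + g u) = trapezoidError f + trapezoidError g := by
  simp only [trapezoidError]
  rw [intervalIntegral.integral_add (hf.intervalIntegrable _ _) (hg.intervalIntegrable _ _)]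
  ring

lemma trapezoidError_const_mul (c : ℝ) (f : ℝ → ℝ) :
    trapezoidError (fun u => c * f u) = c * trapezoidError f := by
  simp only [trapezoidError]
  rw [intervalIntegral.integral_const_mul]
  ring

lemma trapezoidError_neg (f : ℝ → ℝ) :
    trapezoidError (fun u => -f u) = -trapezoidError f := by
  simpa using trapezoidError_const_mul (-1) f

lemma trapezoidError_sub {f g : ℝ → ℝ} (hf : Continuous f) (hg : Continuous g) :
    trapezoidError (fun u => f u - g u) = trapezoidError f - trapezoidError g := by
  simp only [sub_eq_add_neg]
  rw [trapezoidError_add hf hg.fun_neg, trapezoidError_neg]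

lemma trapezoidError_const (c : ℝ) : trapezoidError (fun _ => c) = 0 := by
  simp [trapezoidError]; ring

/-- Integration by parts: the weight 2t - 1 takes the values ∓1 at the endpoints and has derivative
2. -/
lemma trapezoidError_eq_integral {G g : ℝ → ℝ} (hG : ∀ t, HasDerivAt G (g t) t)
    (hg : Continuous g) : ∫ t in (0 : ℝ)..1, (2 * t - 1) * g t = trapezoidError G := by
  have h := intervalIntegral.integral_mul_deriv_eq_deriv_mul (a := 0) (b := 1)
    (u := fun t : ℝ => 2 * t - 1) (u' := fun _ => 2) (v := G) (v' := g)
    (fun t _ => by simpa using ((hasDerivAt_id t).const_mul 2).sub_const 1)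
    (fun t _ => hG t) (by simp) (hg.intervalIntegrable _ _)
  rw [h, intervalIntegral.integral_const_mul, trapezoidError]
  ring

/-- Since 2t - 1 has mean zero, g may be replaced by g - g(1/2); by monotonicity both factors then
change sign at t = 1/2, so the integrand is nonnegative, and it is at most the total variation of g
because |2t - 1| ≤ 1. The upper bound has a form that telescopes over adjacent intervals. -/
lemma trapezoidError_mem_Icc {G g : ℝ → ℝ} (hG : ∀ t, HasDerivAt G (g t) t)
    (hg : Continuous g) (hm : Monotone g) : 0 ≤ trapezoidError G ∧ trapezoidError G ≤ g 1 - g 0 := by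
  have h0 : ∫ t in (0 : ℝ)..1, (2 * t - 1) * (g t - g (1 / 2)) = trapezoidError G := by
    rw [← trapezoidError_eq_integral hG hg]
    have : trapezoidError (fun t => g (1 / 2) * t) = 0 := by
      rw [trapezoidError, intervalIntegral.integral_const_mul, integral_id]
      ring
    rw [← trapezoidError_eq_integral (g := fun _ => g (1 / 2))
      (fun t => by simpa using (hasDerivAt_id t).const_mul (g (1 / 2))) continuous_const] at this
    simp_rw [mul_sub]
    rw [intervalIntegral.integral_sub, this, sub_zero]
    · exact Continuous.intervalIntegrable (by fun_prop) _ _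
    · exact Continuous.intervalIntegrable (by fun_prop) _ _
  rw [← h0]
  constructor
  · refine intervalIntegral.integral_nonneg zero_le_one fun t _ => ?_
    rcases le_total t (1 / 2) with h | h
    · exact mul_nonneg_of_nonpos_of_nonpos (by linarith) (by linarith [hm h])
    · exact mul_nonneg (by linarith) (by linarith [hm h])
  · have : ∫ t in (0 : ℝ)..1, (2 * t - 1) * (g t - g (1 / 2)) ≤ ∫ t in (0 : ℝ)..1, (g 1 - g 0) := by
      refine intervalIntegral.integral_mono_on zero_le_one
        (Continuous.intervalIntegrable (by fun_prop) _ _) (by simp) fun t ht => ?_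
      have h1 := hm ht.1
      have h2 := hm ht.2
      have h3 : g 0 ≤ g (1 / 2) := hm (by norm_num)
      have h4 : g (1 / 2) ≤ g 1 := hm (by norm_num)
      rcases le_total t (1 / 2) with h | h
      · nlinarith [hm h, ht.1]
      · nlinarith [hm h, ht.2]
    simpa using this

/-- A concave function lies above its chord, whose integral is (f(0) + f(1))/2. -/
lemma trapezoidError_nonpos_of_concaveOn {f : ℝ → ℝ} (hc : ConcaveOn ℝ (Set.Icc 0 1) f)
    (hf : Continuous f) : trapezoidError f ≤ 0 := by
  have h : ∫ u in (0 : ℝ)..1, ((1 - u) * f 0 + u * f 1) ≤ ∫ u in (0 : ℝ)..1, f u := by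
    refine intervalIntegral.integral_mono_on zero_le_one
      (Continuous.intervalIntegrable (by fun_prop) _ _) (hf.intervalIntegrable _ _) fun t ht => ?_
    have := hc.2 (x := 0) (y := 1) (by simp) (by simp) (sub_nonneg.2 ht.2) ht.1 (by ring)
    simpa using this
  have h1 : ∫ u in (0 : ℝ)..1, ((1 - u) * f 0 + u * f 1) = (f 0 + f 1) / 2 := by
    rw [intervalIntegral.integral_add (Continuous.intervalIntegrable (by fun_prop) _ _)
      (Continuous.intervalIntegrable (by fun_prop) _ _), intervalIntegral.integral_mul_const,
      intervalIntegral.integral_mul_const, integral_id,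
      intervalIntegral.integral_sub (by simp) (by simp), integral_id]
    simp
    ring
  rw [trapezoidError]
  linarith

lemma abs_trapezoidError_le_of_antitoneOn {f : ℝ → ℝ} (ha : AntitoneOn f (Set.Icc 0 1))
    (hf : Continuous f) : |trapezoidError f| ≤ f 0 - f 1 := by
  have h1 : ∫ u in (0 : ℝ)..1, f u ≤ ∫ u in (0 : ℝ)..1, f 0 :=
    intervalIntegral.integral_mono_on zero_le_one (hf.intervalIntegrable _ _) (by simp)
      fun t ht => ha (by simp) ht ht.1
  have h2 : ∫ u in (0 : ℝ)..1, f 1 ≤ ∫ u in (0 : ℝ)..1, f u :=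
    intervalIntegral.integral_mono_on zero_le_one (by simp) (hf.intervalIntegrable _ _)
      fun t ht => ha ht (by simp) ht.2
  simp only [intervalIntegral.integral_const, sub_zero, one_smul] at h1 h2
  rw [trapezoidError, abs_le]
  constructor <;> linarith

lemma hasDerivAt_unitMean {f : ℝ → ℝ} (hf : Continuous f) (y : ℝ) :
    HasDerivAt (unitMean f) (f (y + 1) - f y) y := by
  have h (x : ℝ) : HasDerivAt (fun x => ∫ t in (0 : ℝ)..x, f t) (f x) x :=
    (hf.integral_hasStrictDerivAt 0 x).hasDerivAt
  have h2 : unitMean f = fun y => (∫ t in (0 : ℝ)..(y + 1), f t) - ∫ t in (0 : ℝ)..y, f t := by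
    ext y
    rw [intervalIntegral.integral_interval_sub_left (hf.intervalIntegrable _ _)
      (hf.intervalIntegrable _ _), unitMean, intervalIntegral.integral_comp_add_left]
    simp
  rw [h2]
  exact ((h (y + 1)).comp_add_const y 1).sub (h y)

lemma continuous_unitMean {f : ℝ → ℝ} (hf : Continuous f) : Continuous (unitMean f) :=
  continuous_iff_continuousAt.2 fun y => (hasDerivAt_unitMean hf y).continuousAt

lemma trapezoidShift_eq (f : ℝ → ℝ) (y : ℝ) :
    trapezoidShift f y = f y + f (y + 1) - 2 * unitMean f y := by
  simp [trapezoidShift, trapezoidError, unitMean]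

lemma continuous_trapezoidShift {f : ℝ → ℝ} (hf : Continuous f) :
    Continuous (trapezoidShift f) := by
  have := continuous_unitMean hf
  simp_rw [funext (trapezoidShift_eq f)]
  fun_prop

lemma trapezoidError_comp_sub (f : ℝ → ℝ) (y : ℝ) :
    trapezoidError (fun v => f (y - v)) = trapezoidShift f (y - 1) := by
  rw [trapezoidShift, ← trapezoidError_reflect]
  congr 1; ext u; congr 1; ring

lemma trapezoidShift_reflect {f : ℝ → ℝ} {c : ℝ} (hf : ∀ x, f (c - x) = f x) (y : ℝ) :
    trapezoidShift f (c - 1 - y) = trapezoidShift f y := by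
  rw [show c - 1 - y = (c - y) - 1 by ring, ← trapezoidError_comp_sub, trapezoidShift]
  congr 1; ext u; rw [← hf]; congr 1; ring

/-- Expands the outer error by linearity. It links the covariance, a double error, to the mean of
`halfPow`, which is what the integrals Q and R produce. -/
lemma trapezoidShift_trapezoidShift {f : ℝ → ℝ} (hf : Continuous f) (y : ℝ) :
    trapezoidShift (trapezoidShift f) y =
      trapezoidShift f y + trapezoidShift f (y + 1) - 2 * trapezoidShift (unitMean f) y := by
  have hm := continuous_unitMean hf
  conv_lhs => rw [trapezoidShift]; simp only [trapezoidShift_eq f]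
  rw [trapezoidError_sub (by fun_prop) (by fun_prop), trapezoidError_add (by fun_prop) (by fun_prop),
    trapezoidError_const_mul]
  have h : (fun u => f (y + u + 1)) = fun u => f (y + 1 + u) := by
    ext u; congr 1; ring
  rw [h]
  rfl

/-! ### The power function `|x| ^ (2H) / 2` -/

/-- The function `|x| ^ (2 H) / 2`. -/
noncomputable def halfPow (H x : ℝ) : ℝ := |x| ^ (2 * H) / 2

/-- The derivative of `halfPow`. -/
noncomputable def halfPowDeriv (H x : ℝ) : ℝ :=
  H * (max x 0 ^ (2 * H - 1) - max (-x) 0 ^ (2 * H - 1))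


lemma halfPowDeriv_of_nonneg (hH : 1 / 2 < H) {x : ℝ} (hx : 0 ≤ x) :
    halfPowDeriv H x = H * x ^ (2 * H - 1) := by
  rw [halfPowDeriv, max_eq_left hx, max_eq_right (by linarith), Real.zero_rpow (by linarith),
    sub_zero]

lemma halfPowDeriv_neg (x : ℝ) : halfPowDeriv H (-x) = -halfPowDeriv H x := by
  simp only [halfPowDeriv, neg_neg]; ring

lemma halfPow_neg (x : ℝ) : halfPow H (-x) = halfPow H x := by simp [halfPow]

lemma halfPow_mul {h : ℝ} (hh : 0 ≤ h) (x : ℝ) :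
    halfPow H (h * x) = h ^ (2 * H) * halfPow H x := by
  rw [halfPow, halfPow, abs_mul, abs_of_nonneg hh, Real.mul_rpow hh (abs_nonneg _)]; ring

lemma continuous_halfPow (hH : 1 / 2 < H) : Continuous (halfPow H) := by
  unfold halfPow
  exact (continuous_abs.rpow_const fun _ => Or.inr (by linarith)).div_const _

lemma continuous_halfPowDeriv (hH : 1 / 2 < H) : Continuous (halfPowDeriv H) := by
  have h : (0 : ℝ) ≤ 2 * H - 1 := by linarith
  unfold halfPowDeriv
  exact continuous_const.mul
    (((continuous_id.max continuous_const).rpow_const fun _ => Or.inr h).sub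
    ((continuous_neg.max continuous_const).rpow_const fun _ => Or.inr h))

lemma monotone_halfPowDeriv (hH : 1 / 2 < H) : Monotone (halfPowDeriv H) := by
  intro x y hxy
  have h : (0 : ℝ) ≤ 2 * H - 1 := by linarith
  unfold halfPowDeriv
  have h1 : max x 0 ^ (2 * H - 1) ≤ max y 0 ^ (2 * H - 1) :=
    Real.rpow_le_rpow (by simp) (by gcongr) h
  have h2 : max (-y) 0 ^ (2 * H - 1) ≤ max (-x) 0 ^ (2 * H - 1) :=
    Real.rpow_le_rpow (by simp) (by gcongr) h
  exact mul_le_mul_of_nonneg_left (by linarith) (by linarith)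

lemma hasDerivAt_halfPow (hH : 1 / 2 < H) (x : ℝ) :
    HasDerivAt (halfPow H) (halfPowDeriv H x) x := by
  have h := (hasDerivAt_abs_rpow x (p := 2 * H) (by linarith)).div_const 2
  convert! h using 1
  -- Both candidate derivatives are odd, so the negative half-line follows from the positive one.
  wlog hx : 0 ≤ x generalizing x
  · have := this (-x) (hasDerivAt_abs_rpow (-x) (p := 2 * H) (by linarith) |>.div_const 2)
      (by linarith)
    rw [halfPowDeriv_neg, abs_neg] at this
    linarith
  rw [halfPowDeriv_of_nonneg hH hx, abs_of_nonneg hx]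
  rcases hx.eq_or_lt with rfl | hx
  · simp [Real.zero_rpow (show 2 * H - 1 ≠ 0 by linarith)]
  · rw [show 2 * H - 1 = 2 * H - 2 + 1 by ring, Real.rpow_add_one hx.ne']
    ring

lemma hasDerivAt_halfPowDeriv (hH : 1 / 2 < H) {x : ℝ} (hx : x ≠ 0) :
    HasDerivAt (halfPowDeriv H) (H * (2 * H - 1) * |x| ^ (2 * H - 2)) x := by
  have key {x : ℝ} (hx : 0 < x) :
      HasDerivAt (halfPowDeriv H) (H * (2 * H - 1) * |x| ^ (2 * H - 2)) x := by
    have h := ((hasDerivAt_id x).rpow_const (p := 2 * H - 1) (Or.inl hx.ne')).const_mul H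
    refine HasDerivAt.congr_of_eventuallyEq (f := fun y => H * y ^ (2 * H - 1)) ?_ ?_
    · convert! h using 1
      rw [abs_of_pos hx, show 2 * H - 1 - 1 = 2 * H - 2 by ring]
      simp; ring
    · filter_upwards [lt_mem_nhds hx] with y hy using halfPowDeriv_of_nonneg hH hy.le
  rcases hx.lt_or_gt with hx | hx
  · have h := ((key (neg_pos.2 hx)).scomp x (hasDerivAt_neg x)).neg
    have he : (fun y => -(halfPowDeriv H ∘ fun y => -y) y) = halfPowDeriv H := by
      ext y; simp [halfPowDeriv_neg]
    convert! h using 1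
    · exact he.symm
    · simp
  · exact key hx

lemma concaveOn_halfPowDeriv (hH : 1 / 2 < H) (hH1 : H < 1) :
    ConcaveOn ℝ (Set.Ici 0) (halfPowDeriv H) := by
  have h := (Real.concaveOn_rpow (p := 2 * H - 1) (by linarith) (by linarith)).smul
    (show 0 ≤ H by linarith)
  exact h.congr fun x hx => by simp [halfPowDeriv_of_nonneg hH hx]

/-- The trapezoidal error of `halfPow` on `[y, y + 1]`. -/
noncomputable def trapPow (H y : ℝ) : ℝ := trapezoidShift (halfPow H) y

lemma continuous_trapPow (hH : 1 / 2 < H) : Continuous (trapPow H) :=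
  continuous_trapezoidShift (continuous_halfPow hH)

lemma trapPow_reflect (y : ℝ) : trapPow H (-1 - y) = trapPow H y := by
  have := trapezoidShift_reflect (f := halfPow H) (c := 0) (by simp [halfPow_neg]) y
  simpa [trapPow] using this

lemma trapPow_nonneg (hH : 1 / 2 < H) (y : ℝ) : 0 ≤ trapPow H y :=
  (trapezoidError_mem_Icc (g := fun u => halfPowDeriv H (y + u))
    (fun t => (hasDerivAt_halfPow hH (y + t)).comp_const_add y t)
    ((continuous_halfPowDeriv hH).comp (by fun_prop))
    fun a b hab => monotone_halfPowDeriv hH (by linarith)).1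

lemma unitMean_halfPowDeriv (hH : 1 / 2 < H) (y : ℝ) :
    unitMean (halfPowDeriv H) y = halfPow H (y + 1) - halfPow H y := by
  rw [unitMean, intervalIntegral.integral_eq_sub_of_hasDerivAt
    (f := fun u => halfPow H (y + u)) (fun t _ => (hasDerivAt_halfPow hH (y + t)).comp_const_add y t)
    (((continuous_halfPowDeriv hH).comp (by fun_prop)).intervalIntegrable _ _)]
  simp

/-- The derivative of `trapPow` is the trapezoidal error of φ', which is concave on [0,∞) because 0
< 2H - 1 < 1; hence it is nonpositive there. -/
lemma antitoneOn_trapPow (hH : 1 / 2 < H) (hH1 : H < 1) :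
    AntitoneOn (trapPow H) (Set.Ici 0) := by
  have hd (y : ℝ) : HasDerivAt (trapPow H) (trapezoidShift (halfPowDeriv H) y) y := by
    have h1 := ((hasDerivAt_halfPow hH y).add ((hasDerivAt_halfPow hH (y + 1)).comp_add_const y 1)).sub
      ((hasDerivAt_unitMean (continuous_halfPow hH) y).const_mul 2)
    convert! h1 using 1
    · ext z; simp [trapPow, trapezoidShift_eq]
    · rw [trapezoidShift_eq, unitMean_halfPowDeriv hH]
  refine antitoneOn_of_deriv_nonpos (convex_Ici 0) (continuous_trapPow hH).continuousOn
    (fun y _ => (hd y).differentiableAt.differentiableWithinAt) fun y hy => ?_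
  rw [(hd y).deriv]
  have hy : 0 < y := by simpa using hy
  refine trapezoidError_nonpos_of_concaveOn ?_ ((continuous_halfPowDeriv hH).comp (by fun_prop))
  have h := (concaveOn_halfPowDeriv hH hH1).translate_right y
  refine (h.subset (fun x hx => ?_) (convex_Icc 0 1)).congr fun x _ => by simp
  have : 0 ≤ x := hx.1
  simp only [Set.mem_preimage, Set.mem_Ici]; positivity

/-! ### Summability of the covariance sequence -/

/-- The covariance sequence of the normalised summands of the Lévy area. -/
noncomputable def areaCov (H : ℝ) (p : ℤ) : ℝ := -trapezoidShift (trapPow H) (p - 1)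

lemma areaCov_neg (p : ℤ) : areaCov H (-p) = areaCov H p := by
  have h := trapezoidShift_reflect (f := trapPow H) (c := -1) (fun x => trapPow_reflect x) (p - 1)
  rw [areaCov, areaCov, ← h]
  push_cast; congr 2; ring

lemma summable_trapPow_sub (hH : 1 / 2 < H) (hH1 : H < 1) :
    Summable fun m : ℕ => trapPow H m - trapPow H (m + 1) := by
  refine summable_of_sum_range_le (c := trapPow H 0) (fun m => ?_) fun m => ?_
  · have := antitoneOn_trapPow hH hH1 (a := (m : ℝ)) (b := m + 1) (by simp)
      (by simp only [Set.mem_Ici]; positivity) (by simp)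
    linarith
  · have := Finset.sum_range_sub' (fun m : ℕ => trapPow H m) m
    push_cast at this
    rw [this]
    linarith [trapPow_nonneg hH (m : ℝ)]

/-- For a monotone function the error is at most the drop across the interval, so the terms are
dominated by a telescoping series of `trapPow`; evenness handles negative indices. -/
lemma summable_areaCov (hH : 1 / 2 < H) (hH1 : H < 1) : Summable (areaCov H) := by
  have h : Summable fun m : ℕ => areaCov H m := by
    -- `areaCov H p` involves `trapPow` on [p - 1, p], which lies in the region of monotonicity only
    -- from p = 1 on.
    rw [← summable_nat_add_iff 1]
    refine (summable_trapPow_sub hH hH1).of_norm_bounded fun m => ?_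
    have := abs_trapezoidError_le_of_antitoneOn (f := fun u => trapPow H (m + u))
      (fun a ha b hb hab => antitoneOn_trapPow hH hH1 (by have := ha.1; simp only [Set.mem_Ici]; positivity)
        (by have := hb.1; simp only [Set.mem_Ici]; positivity) (by linarith))
      ((continuous_trapPow hH).comp (by fun_prop))
    rw [areaCov, Real.norm_eq_abs, abs_neg, trapezoidShift]
    push_cast
    simpa using this
  exact Summable.of_nat_of_neg h (by simpa [areaCov_neg] using h)

lemma trapPow_sub_neg (p : ℤ) : trapPow H ((-p : ℤ) : ℝ) - trapPow H ((-p : ℤ) - 1) =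
    -(trapPow H p - trapPow H (p - 1)) := by
  have h1 := trapPow_reflect (H := H) (p : ℝ)
  have h2 := trapPow_reflect (H := H) (p - 1)
  push_cast
  rw [← h1, ← h2]
  ring_nf

lemma summable_trapPow_sub_int (hH : 1 / 2 < H) (hH1 : H < 1) :
    Summable fun p : ℤ => trapPow H p - trapPow H (p - 1) := by
  have h : Summable fun m : ℕ => trapPow H ((m : ℤ) : ℝ) - trapPow H ((m : ℤ) - 1) := by
    rw [← summable_nat_add_iff 1]
    refine (summable_trapPow_sub hH hH1).neg.congr fun m => ?_
    push_cast; ring_nf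
  refine Summable.of_nat_of_neg h (h.neg.congr fun m => ?_)
  rw [trapPow_sub_neg]

/-- The terms are odd in p, so the sum equals its own negative. -/
lemma tsum_trapPow_sub_int : ∑' p : ℤ, (trapPow H p - trapPow H (p - 1)) = 0 := by
  have h := (Equiv.neg ℤ).tsum_eq fun p : ℤ => trapPow H p - trapPow H (p - 1)
  simp only [Equiv.neg_apply, trapPow_sub_neg, tsum_neg] at h
  linarith

/-! ### Evaluation of Q - R and of the sum ϱ -/

/-- Away from s = t the density is the nonnegative derivative of the continuous function
`halfPowDeriv`, so the singularity on the diagonal is integrable. -/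
lemma intervalIntegrable_muDensity (hH : 1 / 2 < H) (t a b : ℝ) :
    IntervalIntegrable (fun s => muDensity H s t) volume a b := by
  have h0 (c : ℝ) :
      IntervalIntegrable (fun x => H * (2 * H - 1) * |x| ^ (2 * H - 2)) volume 0 c := by
    refine intervalIntegral.intervalIntegrable_deriv_of_nonneg
      (continuous_halfPowDeriv hH).continuousOn (fun x hx => hasDerivAt_halfPowDeriv hH ?_)
      fun x _ => ?_
    · rintro rfl
      rcases le_total 0 c with h | h <;> simp [h] at hx
    · have : 0 ≤ 2 * H - 1 := by linarith
      have : 0 ≤ H := by linarith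
      positivity
  simpa [muDensity] using ((h0 (a - t)).symm.trans (h0 (b - t))).comp_sub_right t

lemma integral_sub_mul_muDensity (hH : 1 / 2 < H) (p t : ℝ) :
    ∫ s in p..(p + 1), (s - p) * muDensity H s t =
      halfPowDeriv H (p + 1 - t) - (halfPow H (p + 1 - t) - halfPow H (p - t)) := by
  have hc := continuous_halfPow hH
  have hc' := continuous_halfPowDeriv hH
  -- Integration by parts in s; the primitive is continuous and fails to be differentiable at most
  -- at the singular point s = t.
  rw [MeasureTheory.integral_eq_of_hasDerivAt_off_countable
    (fun s => (s - p) * halfPowDeriv H (s - t) - halfPow H (s - t)) _ (Set.countable_singleton t)]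
  · ring_nf
  · fun_prop
  · intro s hs
    have hst : s - t ≠ 0 := sub_ne_zero.2 hs.2
    have h1 := (hasDerivAt_halfPowDeriv hH hst).comp_sub_const s t
    have h2 := (hasDerivAt_halfPow hH (s - t)).comp_sub_const s t
    convert! (((hasDerivAt_id s).sub_const p).mul h1).sub h2 using 1
    simp [muDensity]
  · exact (intervalIntegrable_muDensity hH t _ _).continuousOn_mul (by fun_prop)

/-- The weights t and 1 - t of Q and R differ by 2t - 1, so a second integration by parts expresses
Q - R through trapezoidal errors of φ and of its unit mean. The leftover difference of `trapPow` is
odd in p and disappears on summation. -/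
lemma tildeQ_sub_tildeR (hH : 1 / 2 < H) (p : ℤ) :
    tildeQ H p - tildeR H p = (areaCov H p - (trapPow H p - trapPow H (p - 1))) / 2 := by
  have hc := continuous_halfPow hH
  have hc' := continuous_halfPowDeriv hH
  have hm := continuous_unitMean hc
  set g : ℝ → ℝ := fun t =>
    halfPowDeriv H (p + 1 - t) - (halfPow H (p + 1 - t) - halfPow H (p - t)) with hg
  have hQ : tildeQ H p = ∫ t in (0 : ℝ)..1, t * g t := by
    simp only [tildeQ, intervalIntegral.integral_const, smul_eq_mul, mul_one, sub_zero, mul_assoc,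
      intervalIntegral.integral_const_mul, integral_sub_mul_muDensity hH, hg]
  have hR : tildeR H p = ∫ t in (0 : ℝ)..1, (1 - t) * g t := by
    simp only [tildeR, intervalIntegral.integral_const, smul_eq_mul, mul_one, mul_assoc,
      intervalIntegral.integral_const_mul, integral_sub_mul_muDensity hH, hg]
  have h1 : ∫ t in (0 : ℝ)..1, (2 * t - 1) * halfPowDeriv H (p + 1 - t) = -trapPow H p := by
    rw [trapezoidError_eq_integral (G := fun t => -halfPow H (p + 1 - t)) _ (by fun_prop),
      trapezoidError_neg, trapezoidError_comp_sub, trapPow, add_sub_cancel_right]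
    intro t
    simpa using ((hasDerivAt_halfPow hH (p + 1 - t)).comp_const_sub _ t).fun_neg
  have h2 : ∫ t in (0 : ℝ)..1, (2 * t - 1) * -(halfPow H (p + 1 - t) - halfPow H (p - t)) =
      trapezoidShift (unitMean (halfPow H)) (p - 1) := by
    rw [trapezoidError_eq_integral (G := fun t => unitMean (halfPow H) (p - t)) _ (by fun_prop),
      trapezoidError_comp_sub]
    intro t
    convert! (hasDerivAt_unitMean hc (p - t)).comp_const_sub _ t using 3
    ring_nf
  have h3 := trapezoidShift_trapezoidShift hc (p - 1)
  have h4 : tildeQ H p - tildeR H p = -trapPow H p +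
      trapezoidShift (unitMean (halfPow H)) (p - 1) := by
    rw [hQ, hR, ← intervalIntegral.integral_sub (Continuous.intervalIntegrable (by fun_prop) _ _)
      (Continuous.intervalIntegrable (by fun_prop) _ _), ← h1, ← h2,
      ← intervalIntegral.integral_add (Continuous.intervalIntegrable (by fun_prop) _ _)
      (Continuous.intervalIntegrable (by fun_prop) _ _)]
    congr 1; ext t; simp only [hg]; ring
  have h5 : areaCov H p = -trapezoidShift (trapezoidShift (halfPow H)) (p - 1) := rfl
  rw [h4, h5, h3]
  simp only [trapPow, sub_add_cancel]
  ring

lemma summable_tildeQ_sub_tildeR (hH : 1 / 2 < H) (hH1 : H < 1) :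
    Summable fun p : ℤ => tildeQ H p - tildeR H p := by
  simp only [tildeQ_sub_tildeR hH]
  exact ((summable_areaCov hH hH1).sub (summable_trapPow_sub_int hH hH1)).div_const 2

lemma tsum_areaCov (hH : 1 / 2 < H) (hH1 : H < 1) : ∑' p, areaCov H p = 2 * varrho H := by
  simp only [varrho, tildeQ_sub_tildeR hH]
  rw [tsum_div_const, (summable_areaCov hH hH1).tsum_sub (summable_trapPow_sub_int hH hH1),
    tsum_trapPow_sub_int]
  ring

/-! ### Double sums of a sequence depending on j - k -/

/-- Normalised sums of a summable sequence over discrete rectangles converge. -/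
lemma tendsto_sum_sum_sub {γ : ℤ → ℝ} (hγ : Summable γ) {l m : ℕ → ℕ} {a b : ℝ}
    (hl : Tendsto (fun n => (l n : ℝ) / n) atTop (𝓝 a))
    (hm : Tendsto (fun n => (m n : ℝ) / n) atTop (𝓝 b)) :
    Tendsto (fun n : ℕ => (∑ j ∈ Finset.range (l n), ∑ k ∈ Finset.range (m n),
      γ ((j : ℤ) - k)) / n) atTop (𝓝 (min a b * ∑' p, γ p)) := by
  classical
  -- Group the pairs by p = j - k. The diagonal p contains between min(l, m) - |p| and min(l, m)
  -- pairs, so its share tends to min(a, b), and dominated convergence sums over p.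
  set N : ℕ → ℤ → ℕ := fun n p =>
    ((Finset.range (l n) ×ˢ Finset.range (m n)).filter fun x => (x.1 : ℤ) - x.2 = p).card with hN
  have hN1 (n : ℕ) (p : ℤ) : N n p ≤ l n := by
    have : N n p ≤ (Finset.range (l n)).card := by
      refine Finset.card_le_card_of_injOn Prod.fst (fun x hx => ?_) fun x hx y hy hxy => ?_
      · simp only [Finset.coe_filter, Finset.mem_product, Set.mem_ofPred_eq] at hx
        exact hx.1.1
      · simp only [Finset.coe_filter, Set.mem_ofPred_eq] at hx hy
        ext <;> grind
    simpa using this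
  have hN2 (n : ℕ) (p : ℤ) : N n p ≤ m n := by
    have : N n p ≤ (Finset.range (m n)).card := by
      refine Finset.card_le_card_of_injOn Prod.snd (fun x hx => ?_) fun x hx y hy hxy => ?_
      · simp only [Finset.coe_filter, Finset.mem_product, Set.mem_ofPred_eq] at hx
        exact hx.1.2
      · simp only [Finset.coe_filter, Set.mem_ofPred_eq] at hx hy
        ext <;> grind
    simpa using this
  have hN3 (n : ℕ) (p : ℤ) : min (l n) (m n) ≤ N n p + p.natAbs := by
    have : (Finset.range (min (l n) (m n) - p.natAbs)).card ≤ N n p := by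
      -- Start the diagonal at (p⁺, p⁻) and move along it.
      refine Finset.card_le_card_of_injOn (fun i => (i + p.toNat, i + (-p).toNat))
        (fun x hx => ?_) fun x hx y hy hxy => ?_
      · simp only [Finset.coe_range, Set.mem_Iio] at hx
        simp only [Finset.coe_filter, Finset.mem_product, Finset.mem_range, Set.mem_ofPred_eq]
        omega
      · simpa using hxy
    simp only [Finset.card_range] at this
    omega
  have hsum (n : ℕ) : (∑ j ∈ Finset.range (l n), ∑ k ∈ Finset.range (m n), γ ((j : ℤ) - k)) / n =
      ∑' p, (N n p : ℝ) / n * γ p := by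
    have h1 (q : ℤ) : γ q = ∑' p, if q = p then γ p else 0 := by
      rw [tsum_eq_single q fun p hp => by simp [hp.symm]]; simp
    rw [← Finset.sum_product', Finset.sum_congr rfl fun x _ => h1 _, ← Summable.tsum_finsetSum,
      ← tsum_div_const]
    · refine tsum_congr fun p => ?_
      rw [← Finset.sum_filter, Finset.sum_const, nsmul_eq_mul]
      ring
    · intro x _
      exact summable_of_ne_finset_zero (s := {(x.1 : ℤ) - x.2}) fun p hp => by
        simp at hp; simp [Ne.symm hp]
  simp only [hsum]
  rw [← tsum_mul_left]
  obtain ⟨C, hC⟩ := hl.bddAbove_range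
  refine tendsto_tsum_of_dominated_convergence (bound := fun p => C * |γ p|)
    (hγ.abs.mul_left C) (fun p => ?_) (Eventually.of_forall fun n p => ?_)
  · refine Tendsto.mul_const _ ?_
    have hmin := hl.min hm
    have hp : Tendsto (fun n : ℕ => (p.natAbs : ℝ) / n) atTop (𝓝 0) :=
      tendsto_const_div_atTop_nhds_zero_nat _
    refine tendsto_of_tendsto_of_tendsto_of_le_of_le (by simpa using hmin.sub hp) hmin
      (fun n => ?_) fun n => ?_
    · have := hN3 n p
      have : (min (l n) (m n) : ℝ) ≤ N n p + p.natAbs := by exact_mod_cast this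
      have hp : |(p : ℝ)| = p.natAbs := by simp
      rw [min_div_div_right (Nat.cast_nonneg n), ← sub_div, hp]
      gcongr
      linarith
    · refine le_min ?_ ?_
      · gcongr; exact hN1 n p
      · gcongr; exact hN2 n p
  · rw [norm_mul, Real.norm_eq_abs, Real.norm_eq_abs, abs_of_nonneg (by positivity)]
    gcongr
    refine le_trans ?_ (hC ⟨n, rfl⟩)
    simp only
    gcongr
    exact hN1 n p

lemma sum_sum_sub_le {γ : ℤ → ℝ} (hγ : Summable γ) (s : Finset ℕ) :
    ∑ j ∈ s, ∑ k ∈ s, γ ((j : ℤ) - k) ≤ s.card * ∑' p, |γ p| := by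
  rw [← nsmul_eq_mul]
  refine Finset.sum_le_card_nsmul _ _ _ fun j _ => ?_
  calc ∑ k ∈ s, γ ((j : ℤ) - k) ≤ ∑ k ∈ s, |γ ((j : ℤ) - k)| :=
        Finset.sum_le_sum fun _ _ => le_abs_self _
    _ = ∑ q ∈ s.map ⟨fun k : ℕ => (j : ℤ) - k, fun a b h => by simpa using h⟩, |γ q| := by
        rw [Finset.sum_map]; rfl
    _ ≤ _ := hγ.abs.sum_le_tsum _ fun _ _ => abs_nonneg _

/-! ### Riemann sums and Riemann-Stieltjes integrals -/

/-- The endpoint weights x' - ξ and ξ - x are those left by summation by parts with tag ξ; taking ξ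
= x' recovers the left-endpoint rule. -/
lemma abs_sub_integral_le_of_oscillation {g : ℝ → ℝ} (hg : Continuous g) {x ξ x' ε : ℝ}
    (h1 : x ≤ ξ) (h2 : ξ ≤ x')
    (hε : ∀ s ∈ Set.Icc x x', ∀ s' ∈ Set.Icc x x', |g s - g s'| ≤ ε) :
    |(x' - ξ) * g x' + (ξ - x) * g x - ∫ s in x..x', g s| ≤ ε * (x' - x) := by
  have hi (a b : ℝ) : IntervalIntegrable g volume a b := hg.intervalIntegrable _ _
  have e1 : (x' - ξ) * g x' - ∫ s in ξ..x', g s = ∫ s in ξ..x', (g x' - g s) := by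
    rw [intervalIntegral.integral_sub (by simp) (hi _ _)]; simp
  have e2 : (ξ - x) * g x - ∫ s in x..ξ, g s = ∫ s in x..ξ, (g x - g s) := by
    rw [intervalIntegral.integral_sub (by simp) (hi _ _)]; simp
  have b1 : |∫ s in ξ..x', (g x' - g s)| ≤ ε * |x' - ξ| :=
    intervalIntegral.norm_integral_le_of_norm_le_const (C := ε) (f := fun s => g x' - g s) fun s hs => by
      rw [Set.uIoc_of_le h2] at hs
      exact hε _ ⟨by linarith, le_rfl⟩ _ ⟨by linarith [hs.1], hs.2⟩
  have b2 : |∫ s in x..ξ, (g x - g s)| ≤ ε * |ξ - x| :=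
    intervalIntegral.norm_integral_le_of_norm_le_const (C := ε) (f := fun s => g x - g s) fun s hs => by
      rw [Set.uIoc_of_le h1] at hs
      exact hε _ ⟨le_rfl, by linarith⟩ _ ⟨hs.1.le, by linarith [hs.2]⟩
  rw [abs_of_nonneg (sub_nonneg.2 h2)] at b1
  rw [abs_of_nonneg (sub_nonneg.2 h1)] at b2
  rw [← intervalIntegral.integral_add_adjacent_intervals (hi x ξ) (hi ξ x')]
  calc |(x' - ξ) * g x' + (ξ - x) * g x - ((∫ s in x..ξ, g s) + ∫ s in ξ..x', g s)|
      = |(∫ s in ξ..x', (g x' - g s)) + ∫ s in x..ξ, (g x - g s)| := by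
        rw [← e1, ← e2]; ring_nf
    _ ≤ ε * (x' - ξ) + ε * (ξ - x) := (abs_add_le _ _).trans (add_le_add b1 b2)
    _ = ε * (x' - x) := by ring

lemma le_of_partition {N : ℕ} {X : ℕ → ℝ} (hX : ∀ i < N, X i ≤ X (i + 1)) :
    ∀ i ≤ N, X 0 ≤ X i ∧ X i ≤ X N := by
  have h (i j : ℕ) (hj : i + j ≤ N) : X i ≤ X (i + j) := by
    induction j with
    | zero => simp
    | succ j ih => exact (ih (by omega)).trans (hX (i + j) (by omega))
  intro i hi
  have h1 := h 0 i (by omega)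
  have h2 := h i (N - i) (by omega)
  rw [zero_add] at h1
  rw [Nat.add_sub_cancel' hi] at h2
  exact ⟨h1, h2⟩

/-- Generalised Riemann sums of a continuous function converge to its integral. -/
lemma exists_mesh_abs_sum_sub_integral_le {g : ℝ → ℝ} (hg : Continuous g) (a b : ℝ) {ε : ℝ}
    (hε : 0 < ε) : ∃ δ : ℝ, 0 < δ ∧ ∀ (N : ℕ) (X Ξ : ℕ → ℝ), X 0 = a → X N = b →
      (∀ i < N, X i ≤ Ξ i ∧ Ξ i ≤ X (i + 1) ∧ X (i + 1) - X i < δ) →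
      |∑ i ∈ Finset.range N, ((X (i + 1) - Ξ i) * g (X (i + 1)) + (Ξ i - X i) * g (X i)) -
        ∫ s in a..b, g s| ≤ ε * (b - a) := by
  obtain ⟨δ, hδ, hu⟩ := Metric.uniformContinuousOn_iff.1
    (isCompact_Icc.uniformContinuousOn_of_continuous (hg.continuousOn (s := Set.Icc a b))) ε hε
  refine ⟨δ, hδ, fun N X Ξ h0 hN h => ?_⟩
  have hmem := le_of_partition (X := X) (N := N) fun i hi => (h i hi).1.trans (h i hi).2.1
  rw [h0, hN] at hmem
  rw [← h0, ← hN, ← intervalIntegral.sum_integral_adjacent_intervals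
    (fun k _ => hg.intervalIntegrable _ _), ← Finset.sum_sub_distrib]
  refine (Finset.abs_sum_le_sum_abs _ _).trans ?_
  rw [← Finset.sum_range_sub, Finset.mul_sum]
  refine Finset.sum_le_sum fun i hi => ?_
  have hi := Finset.mem_range.1 hi
  obtain ⟨h1, h2, h3⟩ := h i hi
  refine abs_sub_integral_le_of_oscillation hg h1 h2 fun s hs s' hs' => ?_
  have hia := (hmem i hi.le).1
  have hib := (hmem (i + 1) hi).2
  refine (hu s ⟨by linarith [hs.1], by linarith [hs.2]⟩ s' ⟨by linarith [hs'.1], by linarith [hs'.2]⟩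
    ?_).le
  rw [Real.dist_eq, abs_lt]
  constructor <;> linarith [hs.1, hs.2, hs'.1, hs'.2]

/-- Uniform partitions of arbitrarily small mesh exist when a ≤ b. For a > b there are no partitions
at all and every number would qualify. -/
lemma HasRSIntegral.unique {f g : ℝ≥0 → ℝ} {a b : ℝ≥0} (hab : a ≤ b) {I J : ℝ}
    (hI : HasRSIntegral f g a b I) (hJ : HasRSIntegral f g a b J) : I = J := by
  by_contra hne
  have hpos : 0 < |I - J| / 2 := by have := abs_pos.2 (sub_ne_zero.2 hne); positivity
  obtain ⟨δ, hδ, h1⟩ := hI _ hpos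
  obtain ⟨δ', hδ', h2⟩ := hJ _ hpos
  obtain ⟨N, hN⟩ := exists_nat_gt (((b : ℝ) - a) / min δ δ')
  have hm : 0 < min δ δ' := lt_min hδ hδ'
  have hba : (0 : ℝ) ≤ b - a := sub_nonneg.2 (by exact_mod_cast hab)
  have hN0 : (0 : ℝ) < N := lt_of_le_of_lt (by positivity) hN
  have hN0' : (N : ℝ≥0) ≠ 0 := by exact_mod_cast hN0.ne'
  rw [div_lt_iff₀ hm, mul_comm, ← div_lt_iff₀ hN0] at hN
  set x : ℕ → ℝ≥0 := fun i => a + (b - a) * i / N with hx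
  have hstep (i : ℕ) : (x (i + 1) : ℝ) - x i = (b - a) / N := by
    simp only [hx]; push_cast [NNReal.coe_sub hab]; ring
  have hx0 : x 0 = a := by simp [hx]
  have hxN : x N = b := by simp [hx, hN0', add_tsub_cancel_of_le hab]
  have hle (i : ℕ) : x i ≤ x (i + 1) := by
    rw [← NNReal.coe_le_coe]; linarith [hstep i, div_nonneg hba hN0.le]
  have e1 := h1 N x x hx0 hxN fun i _ =>
    ⟨le_rfl, hle i, by rw [hstep]; exact hN.trans_le (min_le_left _ _)⟩
  have e2 := h2 N x x hx0 hxN fun i _ =>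
    ⟨le_rfl, hle i, by rw [hstep]; exact hN.trans_le (min_le_right _ _)⟩
  set S := ∑ i ∈ Finset.range N, f (x i) * (g (x (i + 1)) - g (x i))
  have h3 : |I - J| ≤ |S - J| + |S - I| := by
    have := abs_sub (S - J) (S - I)
    rwa [sub_sub_sub_cancel_left] at this
  linarith

lemma HasRSIntegral.rsIntegral_eq {f g : ℝ≥0 → ℝ} {a b : ℝ≥0} (hab : a ≤ b) {I : ℝ}
    (hI : HasRSIntegral f g a b I) : rsIntegral f g a b = I := by
  have h : ∃ I, HasRSIntegral f g a b I := ⟨I, hI⟩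
  rw [rsIntegral, dif_pos h]
  exact h.choose_spec.unique hab hI

lemma rsIntegral_one_id {a b : ℝ≥0} (hab : a ≤ b) :
    rsIntegral (fun _ => 1) (fun u => (u : ℝ)) a b = b - a := by
  refine HasRSIntegral.rsIntegral_eq hab fun ε hε => ⟨1, one_pos, fun N x ξ h0 hN _ => ?_⟩
  simp only [one_mul]
  rw [Finset.sum_range_sub (fun i => (x i : ℝ)), h0, hN]
  simpa using hε

/-- Summation by parts: an affine function is Riemann-Stieltjes integrable with respect to a
continuous one. -/
lemma hasRSIntegral_of_eqOn_affine {b : ℝ≥0 → ℝ} (hb : Continuous b) {f : ℝ≥0 → ℝ} {a c : ℝ≥0}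
    (hac : a ≤ c) (α β : ℝ) (hf : ∀ s, a ≤ s → s ≤ c → f s = α * s + β) :
    HasRSIntegral f b a c ((α * c + β) * b c - (α * a + β) * b a -
      α * ∫ s in (a : ℝ)..c, b s.toNNReal) := by
  intro ε hε
  have hac' : (0 : ℝ) ≤ c - a := sub_nonneg.2 (by exact_mod_cast hac)
  -- The added ones keep the denominator positive when α = 0 or a = c.
  set η : ℝ := ε / (2 * (|α| + 1) * (c - a + 1)) with hη
  have hηpos : 0 < η := by positivity
  obtain ⟨δ, hδ, h⟩ := exists_mesh_abs_sum_sub_integral_le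
    (g := fun s => b s.toNNReal) (hb.comp continuous_real_toNNReal) (a : ℝ) c hηpos
  refine ⟨δ, hδ, fun N x ξ h0 hN hx => ?_⟩
  have h := h N (fun i => x i) (fun i => ξ i) (by simp [h0]) (by simp [hN]) fun i hi => by
    obtain ⟨h1, h2, h3⟩ := hx i hi
    exact ⟨by exact_mod_cast h1, by exact_mod_cast h2, h3⟩
  simp only [Real.toNNReal_coe] at h
  have hmem := le_of_partition (X := fun i => (x i : ℝ)) (N := N) fun i hi => by
    exact_mod_cast (hx i hi).1.trans (hx i hi).2.1
  have hsum : ∑ i ∈ Finset.range N, f (ξ i) * (b (x (i + 1)) - b (x i)) =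
      (α * c + β) * b c - (α * a + β) * b a - α * ∑ i ∈ Finset.range N,
        (((x (i + 1) : ℝ) - ξ i) * b (x (i + 1)) + (ξ i - x i) * b (x i)) := by
    have ht := Finset.sum_range_sub (fun i => (α * (x i : ℝ) + β) * b (x i)) N
    rw [h0, hN] at ht
    rw [← ht, Finset.mul_sum, ← Finset.sum_sub_distrib]
    refine Finset.sum_congr rfl fun i hi => ?_
    have hi := Finset.mem_range.1 hi
    obtain ⟨h1, h2, h3⟩ := hx i hi
    have ha := (hmem i hi.le).1
    have hc := (hmem (i + 1) hi).2
    simp only [h0, hN, NNReal.coe_le_coe] at ha hc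
    rw [hf (ξ i) (ha.trans h1) (h2.trans hc)]
    ring
  rw [hsum, sub_sub_sub_cancel_left, ← mul_sub, abs_mul, abs_sub_comm]
  calc |α| * _ ≤ |α| * (η * (c - a)) := by gcongr
    _ ≤ (|α| + 1) * (η * (c - a + 1)) := by gcongr <;> linarith
    _ = ε / 2 := by rw [hη]; field_simp
    _ < ε := half_lt_self hε

/-- The inner integrals are s - a and c - s, affine in s. The boundary terms add up to the
trapezoidal rule and the two integrals of b combine. -/
lemma rsIntegral_area_summand {b : ℝ≥0 → ℝ} (hb : Continuous b) {a c : ℝ≥0} (hac : a ≤ c) :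
    rsIntegral (fun s => rsIntegral (fun _ => 1) (fun u => (u : ℝ)) a s) b a c -
      rsIntegral (fun s => rsIntegral (fun _ => 1) (fun u => (u : ℝ)) s c) b a c =
    (c - a) * (b a + b c) - 2 * ∫ s in (a : ℝ)..c, b s.toNNReal := by
  rw [(hasRSIntegral_of_eqOn_affine hb hac 1 (-a) fun s h1 _ => by
      rw [rsIntegral_one_id h1]; ring).rsIntegral_eq hac,
    (hasRSIntegral_of_eqOn_affine hb hac (-1) c fun s _ h2 => by
      rw [rsIntegral_one_id h2]; ring).rsIntegral_eq hac]
  ring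

lemma levyArea_id_eq {b : ℝ≥0 → ℝ} (hb : Continuous b) (T : ℝ≥0) (n : ℕ) (t : ℝ≥0) :
    levyArea T n (fun u => (u : ℝ)) b t =
      ∑ k ∈ Finset.range (⌊(n : ℝ≥0) * t / T⌋₊ + 1),
        (T / n : ℝ) * trapezoidError fun u => b (T / n * (k + u) : ℝ).toNNReal := by
  refine Finset.sum_congr rfl fun k _ => ?_
  have hle : partitionPoint T n k ≤ partitionPoint T n (k + 1) := by
    unfold partitionPoint; gcongr; simp
  have h1 : (partitionPoint T n k : ℝ) = T / n * k := by
    simp only [partitionPoint]; push_cast; ring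
  have h2 : (partitionPoint T n (k + 1) : ℝ) = T / n * k + T / n := by
    simp only [partitionPoint]; push_cast; ring
  have h3 := intervalIntegral.mul_integral_comp_add_mul (a := 0) (b := 1)
    (f := fun s : ℝ => b s.toNNReal) (T / n : ℝ) (T / n * k)
  rw [rsIntegral_area_summand hb hle, trapezoidError, h1, h2]
  have h1' : b (partitionPoint T n k) = b (T / n * k : ℝ).toNNReal := by
    rw [← h1, Real.toNNReal_coe]
  have h2' : b (partitionPoint T n (k + 1)) = b (T / n * k + T / n : ℝ).toNNReal := by
    rw [← h2, Real.toNNReal_coe]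
  rw [h1', h2']
  simp only [mul_zero, mul_one, add_zero] at h3
  rw [← h3]
  simp only [mul_add, mul_one, add_zero]
  ring

/-! ### Discretised trapezoidal error -/

/-- The trapezoidal error with the integral replaced by a Riemann sum. -/
noncomputable def trapezoidErrorSum (N : ℕ) (f : ℝ → ℝ) : ℝ :=
  f 0 + f 1 - 2 * ∑ i ∈ Finset.range N, (1 / N : ℝ) * f (i / N)

lemma tendsto_trapezoidErrorSum {f : ℝ → ℝ} (hf : Continuous f) :
    Tendsto (fun N => trapezoidErrorSum N f) atTop (𝓝 (trapezoidError f)) := by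
  refine Tendsto.const_sub _ (Tendsto.const_mul _ ?_)
  rw [Metric.tendsto_atTop]
  intro ε hε
  obtain ⟨δ, hδ, h⟩ := exists_mesh_abs_sum_sub_integral_le hf 0 1 (half_pos hε)
  obtain ⟨M, hM⟩ := exists_nat_one_div_lt hδ
  refine ⟨M + 1, fun N hN => ?_⟩
  have hN0 : (0 : ℝ) < N := by exact_mod_cast (by omega : 0 < N)
  have hstep (i : ℕ) : ((i + 1 : ℕ) : ℝ) / N - i / N = 1 / N := by push_cast; ring
  have := h N (fun i => i / N) (fun i => ((i + 1 : ℕ) : ℝ) / N) (by simp)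
    (by simp [hN0.ne']) fun i _ => ⟨by gcongr; simp, le_rfl, by
      rw [hstep]
      refine lt_of_le_of_lt ?_ hM
      gcongr
      exact_mod_cast hN⟩
  simp only [sub_self, zero_mul, zero_add, hstep] at this
  rw [Real.dist_eq]
  linarith

lemma trapezoidErrorSum_sub (N : ℕ) (f g : ℝ → ℝ) :
    trapezoidErrorSum N (fun u => f u - g u) = trapezoidErrorSum N f - trapezoidErrorSum N g := by
  simp only [trapezoidErrorSum, mul_sub, Finset.sum_sub_distrib]
  ring

lemma abs_trapezoidErrorSum_le {N : ℕ} {f : ℝ → ℝ} {ε : ℝ}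
    (hf : ∀ u ∈ Set.Icc (0 : ℝ) 1, |f u| ≤ ε) : |trapezoidErrorSum N f| ≤ 4 * ε := by
  have h0 := hf 0 (by simp)
  have h1 := hf 1 (by simp)
  have hε : 0 ≤ ε := (abs_nonneg _).trans h0
  have hs : |∑ i ∈ Finset.range N, (1 / N : ℝ) * f (i / N)| ≤ ε := by
    calc _ ≤ ∑ i ∈ Finset.range N, |(1 / N : ℝ) * f (i / N)| := Finset.abs_sum_le_sum_abs _ _
      _ ≤ ∑ i ∈ Finset.range N, (1 / N : ℝ) * ε := by
        refine Finset.sum_le_sum fun i hi => ?_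
        have hi : (i : ℝ) ≤ N := by exact_mod_cast (Finset.mem_range.1 hi).le
        rw [abs_mul, abs_of_nonneg (by positivity : (0 : ℝ) ≤ 1 / N)]
        gcongr
        exact hf _ ⟨by positivity, div_le_one_of_le₀ hi (by positivity)⟩
      _ ≤ ε := by
        rw [Finset.sum_const, Finset.card_range, nsmul_eq_mul, ← mul_assoc]
        rcases N.eq_zero_or_pos with rfl | hN
        · simpa using hε
        · field_simp; rfl
  rw [trapezoidErrorSum]
  rw [abs_le] at *
  constructor <;> linarith

lemma continuous_trapezoidError_uncurry {F : ℝ → ℝ → ℝ} (hF : Continuous (Function.uncurry F)) :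
    Continuous fun u => trapezoidError (F u) := by
  have h := intervalIntegral.continuous_parametric_intervalIntegral_of_continuous'
    (μ := volume) hF 0 1
  simp only [trapezoidError]
  have h0 : Continuous fun u => F u 0 := hF.comp (by fun_prop : Continuous fun u : ℝ => (u, (0 : ℝ)))
  have h1 : Continuous fun u => F u 1 := hF.comp (by fun_prop : Continuous fun u : ℝ => (u, (1 : ℝ)))
  fun_prop

/-- Uniform continuity on the unit square makes the inner discretisation error small uniformly in u,
so the outer sum, with the same N, cannot amplify it by more than the factor 4. -/
lemma tendsto_trapezoidErrorSum_trapezoidErrorSum {F : ℝ → ℝ → ℝ}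
    (hF : Continuous (Function.uncurry F)) :
    Tendsto (fun N => trapezoidErrorSum N fun u => trapezoidErrorSum N (F u)) atTop
      (𝓝 (trapezoidError fun u => trapezoidError (F u))) := by
  have hFu (u : ℝ) : Continuous (F u) := hF.comp (by fun_prop : Continuous fun v : ℝ => (u, v))
  have key : Tendsto (fun N => trapezoidErrorSum N
      fun u => trapezoidErrorSum N (F u) - trapezoidError (F u)) atTop (𝓝 0) := by
    rw [Metric.tendsto_atTop]
    intro ε hε
    obtain ⟨δ, hδ, hu⟩ := Metric.uniformContinuousOn_iff.1
      ((isCompact_Icc.prod isCompact_Icc).uniformContinuousOn_of_continuous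
        (hF.continuousOn (s := Set.Icc (0 : ℝ) 1 ×ˢ Set.Icc (0 : ℝ) 1))) (ε / 16) (by positivity)
    obtain ⟨M, hM⟩ := exists_nat_one_div_lt hδ
    refine ⟨M + 1, fun N hN => ?_⟩
    have hN0 : (0 : ℝ) < N := by exact_mod_cast (by omega : 0 < N)
    have hstep (i : ℕ) : ((i + 1 : ℕ) : ℝ) / N - i / N = 1 / N := by push_cast; ring
    have hNδ : (1 : ℝ) / N < δ := by
      refine lt_of_le_of_lt ?_ hM
      gcongr
      exact_mod_cast hN
    have hb : ∀ u ∈ Set.Icc (0 : ℝ) 1,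
        |trapezoidErrorSum N (F u) - trapezoidError (F u)| ≤ ε / 8 := by
      intro u hu'
      have hI : |∑ i ∈ Finset.range N, (1 / N : ℝ) * F u (i / N) - ∫ v in (0 : ℝ)..1, F u v| ≤
          ε / 16 := by
        have hadj := intervalIntegral.sum_integral_adjacent_intervals
          (f := F u) (μ := volume) (a := fun i : ℕ => (i : ℝ) / N) (n := N)
          (fun k _ => (hFu u).intervalIntegrable _ _)
        simp only [Nat.cast_zero, zero_div, div_self hN0.ne'] at hadj
        rw [← hadj, ← Finset.sum_sub_distrib]
        refine (Finset.abs_sum_le_sum_abs _ _).trans ?_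
        calc _ ≤ ∑ i ∈ Finset.range N, ε / 16 * (1 / N) := by
              refine Finset.sum_le_sum fun i hi => ?_
              have hi : ((i + 1 : ℕ) : ℝ) ≤ N := by exact_mod_cast Finset.mem_range.1 hi
              have h1 : ((i + 1 : ℕ) : ℝ) / N ≤ 1 := div_le_one_of_le₀ hi (by positivity)
              have h0 : (0 : ℝ) ≤ i / N := by positivity
              have := abs_sub_integral_le_of_oscillation (hFu u) (x := (i : ℝ) / N)
                (ξ := ((i + 1 : ℕ) : ℝ) / N) (x' := ((i + 1 : ℕ) : ℝ) / N) (ε := ε / 16)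
                (by gcongr; simp) le_rfl fun s hs s' hs' => by
                  refine (hu (u, s) ⟨hu', by linarith [hs.1], by linarith [hs.2]⟩
                    (u, s') ⟨hu', by linarith [hs'.1], by linarith [hs'.2]⟩ ?_).le
                  rw [Prod.dist_eq, dist_self, max_eq_right dist_nonneg, Real.dist_eq, abs_lt]
                  have := hstep i
                  constructor <;> linarith [hs.1, hs.2, hs'.1, hs'.2]
              simpa only [sub_self, zero_mul, zero_add, hstep] using this
          _ = ε / 16 := by simp; field_simp
      rw [trapezoidErrorSum, trapezoidError, sub_sub_sub_cancel_left, ← mul_sub, abs_mul,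
        abs_sub_comm, abs_two]
      linarith
    rw [Real.dist_eq, sub_zero]
    have := abs_trapezoidErrorSum_le (N := N) hb
    linarith
  have h2 := key.add (tendsto_trapezoidErrorSum (continuous_trapezoidError_uncurry hF))
  rw [zero_add] at h2
  refine h2.congr fun N => ?_
  rw [trapezoidErrorSum_sub]
  ring

/-! ### Centred Gaussian families -/

/-- `X` is a finite centred Gaussian family with covariance `C`. -/
structure IsCenteredGaussian {Ω κ : Type*} [MeasurableSpace Ω] [Fintype κ] (X : κ → Ω → ℝ)
    (C : κ → κ → ℝ) (P : Measure Ω) : Prop where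
  aemeasurable : ∀ k, AEMeasurable (X k) P
  charFun_eq : ∀ d : κ → ℝ, ∫ ω, Complex.exp ((∑ k, d k * X k ω : ℝ) * Complex.I) ∂P =
    Complex.exp (-(∑ k, ∑ l, d k * d l * C k l : ℝ) / 2)

/-- The bilinear form with matrix `R` on finitely supported functions. -/
noncomputable def covForm {ι : Type*} (R : ι → ι → ℝ) : (ι →₀ ℝ) →ₗ[ℝ] (ι →₀ ℝ) →ₗ[ℝ] ℝ :=
  Finsupp.linearCombination ℝ fun i => Finsupp.linearCombination ℝ (R i)

lemma covForm_apply {ι : Type*} (R : ι → ι → ℝ) (c c' : ι →₀ ℝ) :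
    covForm R c c' = Finsupp.linearCombination ℝ
      (fun i => Finsupp.linearCombination ℝ (R i) c') c := by
  simp [covForm, Finsupp.linearCombination_apply, Finsupp.sum]

lemma covForm_sum_smul {ι κ : Type*} [Fintype κ] (R : ι → ι → ℝ) (c : κ → ι →₀ ℝ) (d : κ → ℝ) :
    covForm R (∑ k, d k • c k) (∑ k, d k • c k) =
      ∑ k, ∑ l, d k * d l * covForm R (c k) (c l) := by
  simp only [map_sum, map_smul, LinearMap.sum_apply, LinearMap.smul_apply, smul_eq_mul,
    Finset.mul_sum]
  rw [Finset.sum_comm]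
  exact Finset.sum_congr rfl fun k _ => Finset.sum_congr rfl fun l _ => by ring

section
variable {Ω κ ι : Type*} [MeasurableSpace Ω] {P : Measure Ω} [IsProbabilityMeasure P]

/-- A finite combination of a centred Gaussian process is a real Gaussian whose variance is the
quadratic form `covForm R c c`. -/
lemma integral_cexp_linearCombination {X : ι → Ω → ℝ} {R : ι → ι → ℝ}
    (hX : IsGaussianProcess X P) (h0 : ∀ i, ∫ ω, X i ω ∂P = 0)
    (hR : ∀ i j, ∫ ω, X i ω * X j ω ∂P = R i j) (c : ι →₀ ℝ) :
    ∫ ω, Complex.exp ((Finsupp.linearCombination ℝ (fun i => X i ω) c : ℝ) * Complex.I) ∂P =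
      Complex.exp (-(covForm R c c : ℝ) / 2) := by
  have hmem (i : ι) : MemLp (X i) 2 P := (hX.hasGaussianLaw_eval i).memLp_two
  have hY : HasGaussianLaw (fun ω => ∑ i ∈ c.support, c i * X i ω) P :=
    (hX.smul c).hasGaussianLaw_fun_sum (I := c.support)
  have hmean : ∫ ω, ∑ i ∈ c.support, c i * X i ω ∂P = 0 := by
    rw [integral_finsetSum _ fun i _ => ((hmem i).integrable one_le_two).const_mul _]
    simp [integral_const_mul, h0]
  have hvar : Var[fun ω => ∑ i ∈ c.support, c i * X i ω; P] = covForm R c c := by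
    rw [variance_of_integral_eq_zero hY.aemeasurable hmean]
    simp_rw [sq, Finset.sum_mul_sum]
    simp only [covForm_apply, Finsupp.linearCombination_apply, Finsupp.sum,
      smul_eq_mul, Finset.mul_sum]
    have hint (i j : ι) : Integrable (fun ω => c i * X i ω * (c j * X j ω)) P := by
      have := ((hmem i).integrable_mul (hmem j)).const_mul (c i * c j)
      refine this.congr (Eventually.of_forall fun ω => ?_)
      simp only [Pi.mul_apply]; ring
    rw [integral_finsetSum _ fun i _ => integrable_finsetSum _ fun j _ => hint i j]
    refine Finset.sum_congr rfl fun i _ => ?_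
    rw [integral_finsetSum _ fun j _ => hint i j]
    refine Finset.sum_congr rfl fun j _ => ?_
    rw [← hR, ← integral_const_mul, ← integral_const_mul]
    congr 1; ext ω; ring
  have h := hY.charFun_map_eq (1 : ℝ)
  rw [charFun_apply_real, integral_map hY.aemeasurable (by fun_prop)] at h
  simp only [Finsupp.linearCombination_apply, Finsupp.sum, smul_eq_mul] at *
  simp only [Complex.ofReal_one, one_mul] at h
  rw [h]
  simp only [RCLike.inner_apply, conj_trivial, mul_one, hmean, hvar]
  simp [neg_div]

/-- The characteristic functions pass to the limit by dominated convergence, the integrands having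
modulus one. Thus the integral functionals of B are Gaussian as almost sure limits of finite
combinations of its values, and their covariances come from limits of `covForm`. -/
lemma isCenteredGaussian_of_tendsto [Fintype κ] {X : ι → Ω → ℝ} {R : ι → ι → ℝ}
    (hX : IsGaussianProcess X P) (h0 : ∀ i, ∫ ω, X i ω ∂P = 0)
    (hR : ∀ i j, ∫ ω, X i ω * X j ω ∂P = R i j) {c : ℕ → κ → ι →₀ ℝ} {Z : κ → Ω → ℝ}
    {C : κ → κ → ℝ}
    (hZ : ∀ k, ∀ᵐ ω ∂P, Tendsto (fun N => Finsupp.linearCombination ℝ (fun i => X i ω) (c N k))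
      atTop (𝓝 (Z k ω)))
    (hC : ∀ k l, Tendsto (fun N => covForm R (c N k) (c N l)) atTop (𝓝 (C k l))) :
    IsCenteredGaussian Z C P := by
  have hm (e : ι →₀ ℝ) :
      AEMeasurable (fun ω => Finsupp.linearCombination ℝ (fun i => X i ω) e) P := by
    simp only [Finsupp.linearCombination_apply, Finsupp.sum, smul_eq_mul]
    exact Finset.aemeasurable_fun_sum _ fun i _ => (hX.aemeasurable i).const_mul _
  refine ⟨fun k => aemeasurable_of_tendsto_metrizable_ae' (fun N => hm (c N k)) (hZ k),
    fun d => ?_⟩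
  have h1 : Tendsto (fun N => ∫ ω, Complex.exp ((Finsupp.linearCombination ℝ (fun i => X i ω)
      (∑ k, d k • c N k) : ℝ) * Complex.I) ∂P) atTop
      (𝓝 (∫ ω, Complex.exp ((∑ k, d k * Z k ω : ℝ) * Complex.I) ∂P)) := by
    refine tendsto_integral_of_dominated_convergence (fun _ => 1) (fun N => ?_)
      (integrable_const _) (fun N => ?_) ?_
    · have := hm (∑ k, d k • c N k)
      exact AEMeasurable.aestronglyMeasurable (by fun_prop)
    · exact Eventually.of_forall fun ω => (Complex.norm_exp_ofReal_mul_I _).le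
    · filter_upwards [ae_all_iff.2 hZ] with ω hω
      refine (Complex.continuous_exp.tendsto _).comp (Tendsto.mul_const _ ?_)
      refine (Complex.continuous_ofReal.tendsto _).comp ?_
      simp only [map_sum, map_smul, smul_eq_mul]
      exact tendsto_finsetSum _ fun k _ => (hω k).const_mul _
  refine tendsto_nhds_unique h1 ?_
  simp only [integral_cexp_linearCombination hX h0 hR, covForm_sum_smul]
  refine (Complex.continuous_exp.tendsto _).comp (Tendsto.div_const (Tendsto.neg ?_) _)
  refine (Complex.continuous_ofReal.tendsto _).comp ?_
  exact tendsto_finsetSum _ fun k _ => tendsto_finsetSum _ fun l _ => (hC k l).const_mul _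

lemma isCenteredGaussian_of_isGaussianProcess [Fintype κ] {X : ι → Ω → ℝ} {R : ι → ι → ℝ}
    (hX : IsGaussianProcess X P) (h0 : ∀ i, ∫ ω, X i ω ∂P = 0)
    (hR : ∀ i j, ∫ ω, X i ω * X j ω ∂P = R i j) (a : κ → ℝ) (τ : κ → ι) :
    IsCenteredGaussian (fun k ω => a k * X (τ k) ω)
      (fun k l => a k * a l * R (τ k) (τ l)) P := by
  refine isCenteredGaussian_of_tendsto hX h0 hR (c := fun _ k => Finsupp.single (τ k) (a k))
    (fun k => ?_) fun k l => ?_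
  · simp
  · simp [covForm, mul_assoc]

lemma IsCenteredGaussian.sumElim {κ' : Type*} [Fintype κ] [Fintype κ'] {X : κ → Ω → ℝ}
    {Y : κ' → Ω → ℝ} {C : κ → κ → ℝ} {D : κ' → κ' → ℝ} (hX : IsCenteredGaussian X C P)
    (hY : IsCenteredGaussian Y D P) (h : IndepFun (fun ω k => X k ω) (fun ω k => Y k ω) P) :
    IsCenteredGaussian (Sum.elim X Y)
      (Sum.elim (fun k => Sum.elim (C k) fun _ => 0) fun k => Sum.elim (fun _ => 0) (D k)) P := by
  refine ⟨by rintro (k | k); exacts [hX.aemeasurable k, hY.aemeasurable k], fun d => ?_⟩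
  have hXm := hX.aemeasurable
  have hYm := hY.aemeasurable
  have hi := h.comp (φ := fun x => ∑ k, d (.inl k) * x k) (ψ := fun x => ∑ k, d (.inr k) * x k)
    (by fun_prop) (by fun_prop)
  have hc := congrFun (hi.charFun_map_fun_add_eq_mul
    (Finset.aemeasurable_fun_sum _ fun k _ => (hXm k).const_mul _)
    (Finset.aemeasurable_fun_sum _ fun k _ => (hYm k).const_mul _)) 1
  simp only [Pi.mul_apply, charFun_apply_real] at hc
  have hXs : AEMeasurable (fun ω => ∑ k, d (.inl k) * X k ω) P :=
    Finset.aemeasurable_fun_sum _ fun k _ => (hXm k).const_mul _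
  have hYs : AEMeasurable (fun ω => ∑ k, d (.inr k) * Y k ω) P :=
    Finset.aemeasurable_fun_sum _ fun k _ => (hYm k).const_mul _
  rw [integral_map (hXs.fun_add hYs) (by fun_prop), integral_map hXs (by fun_prop),
    integral_map hYs (by fun_prop)] at hc
  simp only [Complex.ofReal_one, one_mul] at hc
  simp only [Fintype.sum_sum_type, Sum.elim_inl, Sum.elim_inr]
  rw [hc, hX.charFun_eq, hY.charFun_eq, ← Complex.exp_add]
  simp only [mul_zero, Finset.sum_const_zero, add_zero, zero_add]
  congr 1; push_cast; ring

/-- A characteristic function has modulus at most one, so exp(-q/2) ≤ 1 for the quadratic form q. -/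
lemma IsCenteredGaussian.cov_nonneg [Fintype κ] {X : κ → Ω → ℝ} {C : κ → κ → ℝ}
    (hX : IsCenteredGaussian X C P) (d : κ → ℝ) : 0 ≤ ∑ k, ∑ l, d k * d l * C k l := by
  have h1 : ‖∫ ω, Complex.exp ((∑ k, d k * X k ω : ℝ) * Complex.I) ∂P‖ ≤ 1 := by
    refine (norm_integral_le_integral_norm _).trans ?_
    simp only [Complex.norm_exp_ofReal_mul_I]
    simp
  rw [hX.charFun_eq, Complex.norm_exp] at h1
  have h2 := Real.exp_le_one_iff.1 h1
  rw [← Complex.ofReal_neg, ← Complex.ofReal_ofNat, ← Complex.ofReal_div, Complex.ofReal_re] at h2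
  linarith

/-- Scaling d by t gives the whole characteristic function of the combination. This recovers the
second moments from a definition stated only through characteristic functions. -/
lemma IsCenteredGaussian.hasLaw [Fintype κ] {X : κ → Ω → ℝ} {C : κ → κ → ℝ}
    (hX : IsCenteredGaussian X C P) (d : κ → ℝ) :
    HasLaw (fun ω => ∑ k, d k * X k ω)
      (gaussianReal 0 (∑ k, ∑ l, d k * d l * C k l).toNNReal) P := by
  have hm : AEMeasurable (fun ω => ∑ k, d k * X k ω) P :=
    Finset.aemeasurable_fun_sum _ fun k _ => (hX.aemeasurable k).const_mul _
  have := Measure.isProbabilityMeasure_map hm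
  refine ⟨hm, Measure.ext_of_charFun (funext fun t => ?_)⟩
  rw [charFun_apply_real, integral_map hm (by fun_prop), charFun_gaussianReal]
  have h := hX.charFun_eq fun k => t * d k
  have h1 (ω : Ω) : ∑ k, t * d k * X k ω = t * ∑ k, d k * X k ω := by
    simp only [Finset.mul_sum, mul_assoc]
  have h2 : ∑ k, ∑ l, t * d k * (t * d l) * C k l = t ^ 2 * ∑ k, ∑ l, d k * d l * C k l := by
    simp only [Finset.mul_sum]
    exact Finset.sum_congr rfl fun k _ => Finset.sum_congr rfl fun l _ => by ring
  simp only [h1, h2, Complex.ofReal_mul t] at h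
  rw [h]
  have h3 : (((∑ k, ∑ l, d k * d l * C k l).toNNReal : ℝ) : ℂ) =
      ((∑ k, ∑ l, d k * d l * C k l : ℝ) : ℂ) := by
    rw [Real.coe_toNNReal _ (hX.cov_nonneg d)]
  rw [h3]
  congr 1
  push_cast
  ring

lemma IsCenteredGaussian.memLp_two [Fintype κ] {X : κ → Ω → ℝ} {C : κ → κ → ℝ}
    (hX : IsCenteredGaussian X C P) (d : κ → ℝ) : MemLp (fun ω => ∑ k, d k * X k ω) 2 P :=
  (hX.hasLaw d).hasGaussianLaw.memLp_two

lemma IsCenteredGaussian.integral_sq [Fintype κ] {X : κ → Ω → ℝ} {C : κ → κ → ℝ}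
    (hX : IsCenteredGaussian X C P) (d : κ → ℝ) :
    ∫ ω, (∑ k, d k * X k ω) ^ 2 ∂P = ∑ k, ∑ l, d k * d l * C k l := by
  have h := hX.hasLaw d
  have hv := h.variance_eq
  have hm := h.integral_eq
  rw [integral_id_gaussianReal] at hm
  rw [variance_of_integral_eq_zero h.aemeasurable hm, variance_id_gaussianReal,
    Real.coe_toNNReal _ (hX.cov_nonneg d)] at hv
  exact hv

end

/-- Lévy's continuity theorem. The vectors are moved to `EuclideanSpace`, where characteristic
functions use the inner product, and back by continuous mapping. -/
lemma tendstoInDistribution_of_isCenteredGaussian {Ω Ω' κ : Type*} [MeasurableSpace Ω]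
    [MeasurableSpace Ω'] {P : Measure Ω} [IsProbabilityMeasure P] {P' : Measure Ω'}
    [IsProbabilityMeasure P'] [Fintype κ] {X : ℕ → κ → Ω → ℝ} {C : ℕ → κ → κ → ℝ}
    {Y : κ → Ω' → ℝ} {D : κ → κ → ℝ} (hX : ∀ n, IsCenteredGaussian (X n) (C n) P)
    (hY : IsCenteredGaussian Y D P')
    (hC : ∀ k l, Tendsto (fun n => C n k l) atTop (𝓝 (D k l))) :
    TendstoInDistribution (fun n ω k => X n k ω) atTop (fun ω k => Y k ω) (fun _ => P) P' := by
  have hXm (n : ℕ) : AEMeasurable (fun ω => WithLp.toLp 2 fun k => X n k ω) P :=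
    (PiLp.continuous_toLp 2 _).measurable.comp_aemeasurable
      (aemeasurable_pi_lambda _ (hX n).aemeasurable)
  have hYm : AEMeasurable (fun ω => WithLp.toLp 2 fun k => Y k ω) P' :=
    (PiLp.continuous_toLp 2 _).measurable.comp_aemeasurable
      (aemeasurable_pi_lambda _ hY.aemeasurable)
  have h : TendstoInDistribution (E := EuclideanSpace ℝ κ)
      (fun n ω => WithLp.toLp 2 fun k => X n k ω) atTop
      (fun ω => WithLp.toLp 2 fun k => Y k ω) (fun _ => P) P' := by
    refine ⟨hXm, hYm, ProbabilityMeasure.tendsto_of_tendsto_charFun fun t => ?_⟩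
    simp only [ProbabilityMeasure.coe_mk, charFun_apply]
    rw [integral_map hYm (by fun_prop)]
    simp_rw [integral_map (hXm _) (by fun_prop : AEStronglyMeasurable
      (fun x : EuclideanSpace ℝ κ => Complex.exp ((inner ℝ x t : ℝ) * Complex.I)) _)]
    simp only [PiLp.inner_apply, RCLike.inner_apply, conj_trivial]
    simp only [(hX _).charFun_eq, hY.charFun_eq]
    refine (Complex.continuous_exp.tendsto _).comp (Tendsto.div_const (Tendsto.neg ?_) _)
    refine (Complex.continuous_ofReal.tendsto _).comp ?_
    exact tendsto_finsetSum _ fun k _ => tendsto_finsetSum _ fun l _ => (hC k l).const_mul _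
  exact h.continuous_comp (PiLp.continuous_ofLp 2 _)

/-! ### The Gaussian family formed by the Lévy area process and the fractional Brownian motion -/

lemma trapezoidError_congr {f g : ℝ → ℝ} (h : ∀ u ∈ Set.Icc (0 : ℝ) 1, f u = g u) :
    trapezoidError f = trapezoidError g := by
  rw [trapezoidError, trapezoidError, h 0 (by simp), h 1 (by simp),
    intervalIntegral.integral_congr fun u hu => h u (by simpa using hu)]

lemma trapezoidErrorSum_const_mul (N : ℕ) (c : ℝ) (f : ℝ → ℝ) :
    trapezoidErrorSum N (fun u => c * f u) = c * trapezoidErrorSum N f := by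
  simp only [trapezoidErrorSum, mul_left_comm _ c, ← Finset.mul_sum]
  ring

/-- The covariance function of fractional Brownian motion. -/
noncomputable def fbmCov (H : ℝ) (s t : ℝ≥0) : ℝ :=
  halfPow H s + halfPow H t - halfPow H (s - t)

lemma fbmCov_comm (s t : ℝ≥0) : fbmCov H s t = fbmCov H t s := by
  rw [fbmCov, fbmCov, ← halfPow_neg ((s : ℝ) - t), neg_sub]
  ring

/-- The point `h (k + u)` of the `k`-th interval of the partition with mesh `h`. -/
noncomputable def gridPoint (h : ℝ) (k : ℕ) (u : ℝ) : ℝ≥0 := (h * (k + u)).toNNReal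

lemma continuous_gridPoint (h : ℝ) (k : ℕ) : Continuous (gridPoint h k) :=
  continuous_real_toNNReal.comp (by fun_prop)

lemma coe_gridPoint {h : ℝ} (hh : 0 ≤ h) (k : ℕ) {u : ℝ} (hu : u ∈ Set.Icc (0 : ℝ) 1) :
    (gridPoint h k u : ℝ) = h * (k + u) :=
  Real.coe_toNNReal _ (mul_nonneg hh (add_nonneg k.cast_nonneg hu.1))

/-- The finitely supported measure on the grid which discretises a summand of the Lévy area. -/
noncomputable def areaRule (h : ℝ) (N k : ℕ) : ℝ≥0 →₀ ℝ :=
  h • (Finsupp.single (gridPoint h k 0) 1 + Finsupp.single (gridPoint h k 1) 1 -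
    (2 : ℝ) • ∑ i ∈ Finset.range N, Finsupp.single (gridPoint h k (i / N)) (1 / N : ℝ))

lemma linearCombination_areaRule (h : ℝ) (N k : ℕ) (f : ℝ≥0 → ℝ) :
    Finsupp.linearCombination ℝ f (areaRule h N k) =
      h * trapezoidErrorSum N fun u => f (gridPoint h k u) := by
  simp only [areaRule, map_smul, map_sub, map_add, map_sum, Finsupp.linearCombination_single,
    smul_eq_mul, one_mul, trapezoidErrorSum]

lemma tendsto_linearCombination_areaRule (h : ℝ) (k : ℕ) {f : ℝ≥0 → ℝ} (hf : Continuous f) :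
    Tendsto (fun N => Finsupp.linearCombination ℝ f (areaRule h N k)) atTop
      (𝓝 (h * trapezoidError fun u => f (gridPoint h k u))) := by
  simp only [linearCombination_areaRule]
  exact (tendsto_trapezoidErrorSum (hf.comp (continuous_gridPoint h k))).const_mul h

lemma continuous_fbmCov (hH : 1 / 2 < H) : Continuous (Function.uncurry (fbmCov H)) := by
  have := continuous_halfPow hH
  simp only [Function.uncurry_def, fbmCov]
  fun_prop

/-- The terms φ(s) and φ(t) are each constant in one variable and are annihilated; φ(s - t) scales
by h^{2H} and depends only on j - k. -/
lemma trapezoidError_trapezoidError_fbmCov (hH : 1 / 2 < H) {h : ℝ} (hh : 0 ≤ h) (j k : ℕ) :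
    trapezoidError (fun u => trapezoidError fun v => fbmCov H (gridPoint h j u) (gridPoint h k v)) =
      h ^ (2 * H) * areaCov H (j - k) := by
  have hc := continuous_halfPow hH
  have h1 : ∀ u ∈ Set.Icc (0 : ℝ) 1,
      (trapezoidError fun v => fbmCov H (gridPoint h j u) (gridPoint h k v)) =
      trapezoidError (fun v => halfPow H (h * (k + v))) -
        h ^ (2 * H) * trapPow H ((j - k - 1 : ℝ) + u) := by
    intro u hu
    rw [trapezoidError_congr (g := fun v => (halfPow H (h * (j + u)) + halfPow H (h * (k + v))) -
      h ^ (2 * H) * halfPow H ((j - k + u : ℝ) - v)) fun v hv => by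
        rw [fbmCov, coe_gridPoint hh j hu, coe_gridPoint hh k hv, ← halfPow_mul hh]
        ring_nf]
    rw [trapezoidError_sub (by fun_prop) (by fun_prop), trapezoidError_add (by fun_prop)
      (by fun_prop), trapezoidError_const, trapezoidError_const_mul, trapezoidError_comp_sub,
      trapPow]
    ring_nf
  rw [trapezoidError_congr h1, trapezoidError_sub (by fun_prop)
    (by have := continuous_trapPow hH; fun_prop), trapezoidError_const,
    trapezoidError_const_mul, areaCov, trapezoidShift]
  push_cast
  ring

lemma tendsto_covForm_areaRule (hH : 1 / 2 < H) {h : ℝ} (hh : 0 ≤ h) (j k : ℕ) :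
    Tendsto (fun N => covForm (fbmCov H) (areaRule h N j) (areaRule h N k)) atTop
      (𝓝 (h * (h * (h ^ (2 * H) * areaCov H (j - k))))) := by
  have hF : Continuous (Function.uncurry fun u v : ℝ =>
      fbmCov H (gridPoint h j u) (gridPoint h k v)) :=
    (continuous_fbmCov hH).comp (((continuous_gridPoint h j).comp continuous_fst).prodMk
      ((continuous_gridPoint h k).comp continuous_snd))
  rw [← trapezoidError_trapezoidError_fbmCov hH hh]
  simp only [covForm_apply, linearCombination_areaRule, trapezoidErrorSum_const_mul]
  exact ((tendsto_trapezoidErrorSum_trapezoidErrorSum hF).const_mul h).const_mul h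

/-- The covariance between a summand of the Lévy area and a value of the process. -/
noncomputable def crossCov (H h : ℝ) (k : ℕ) (r : ℝ≥0) : ℝ :=
  h * trapezoidError fun u => fbmCov H r (gridPoint h k u)

/-- Up to constants, the covariance is the error of φ minus that of φ(· - r). Each of these is
nonnegative and bounded by an increment of the increasing function hφ', so the sums over k
telescope; no decay in |j - k| is needed. -/
lemma abs_sum_crossCov_le (hH : 1 / 2 < H) {h : ℝ} (hh : 0 ≤ h) (l : ℕ) (r : ℝ≥0) :
    |∑ k ∈ Finset.range l, crossCov H h k r| ≤
      h * (h * (2 * halfPowDeriv H (h * l) + halfPowDeriv H r)) := by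
  have hc := continuous_halfPow hH
  have hc' := continuous_halfPowDeriv hH
  have hm := monotone_halfPowDeriv hH
  have hd0 : halfPowDeriv H 0 = 0 := by
    have := halfPowDeriv_neg (H := H) 0
    rw [neg_zero] at this; linarith
  have key (x : ℝ) : 0 ≤ ∑ k ∈ Finset.range l, (trapezoidError fun u => halfPow H (h * (k + u) - x)) ∧
      ∑ k ∈ Finset.range l, (trapezoidError fun u => halfPow H (h * (k + u) - x)) ≤
        h * (halfPowDeriv H (h * l - x) - halfPowDeriv H (-x)) := by
    have h1 (k : ℕ) := trapezoidError_mem_Icc (G := fun u => halfPow H (h * (k + u) - x))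
      (g := fun u => h * halfPowDeriv H (h * (k + u) - x)) (fun t => by
        have h2 : HasDerivAt (fun u : ℝ => h * (k + u) - x) h t := by
          simpa using (((hasDerivAt_id t).const_add (k : ℝ)).const_mul h).sub_const x
        simpa [mul_comm h, Function.comp_def] using! (hasDerivAt_halfPow hH _).comp t h2)
      (by fun_prop) fun a b hab => mul_le_mul_of_nonneg_left (hm (by gcongr)) hh
    refine ⟨Finset.sum_nonneg fun k _ => (h1 k).1,
      (Finset.sum_le_sum fun k _ => (h1 k).2).trans ?_⟩
    have h3 := Finset.sum_range_sub (fun k : ℕ => h * halfPowDeriv H (h * k - x)) l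
    push_cast at h3
    simp only [add_zero]
    rw [h3]
    apply le_of_eq
    simp; ring
  have e : ∑ k ∈ Finset.range l, crossCov H h k r = h *
      (∑ k ∈ Finset.range l, (trapezoidError fun u => halfPow H (h * (k + u) - 0)) -
        ∑ k ∈ Finset.range l, (trapezoidError fun u => halfPow H (h * (k + u) - r))) := by
    rw [← Finset.sum_sub_distrib, Finset.mul_sum]
    refine Finset.sum_congr rfl fun k _ => ?_
    rw [crossCov, trapezoidError_congr (g := fun u => (halfPow H r + halfPow H (h * (k + u) - 0)) -
      halfPow H (h * (k + u) - r)) fun u hu => by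
        rw [fbmCov_comm, fbmCov, coe_gridPoint hh k hu]; ring_nf,
      trapezoidError_sub (by fun_prop) (by fun_prop), trapezoidError_add (by fun_prop)
      (by fun_prop), trapezoidError_const, zero_add]
  rw [e, abs_mul, abs_of_nonneg hh]
  refine mul_le_mul_of_nonneg_left ?_ hh
  obtain ⟨a1, a2⟩ := key 0
  obtain ⟨b1, b2⟩ := key r
  have hmono : halfPowDeriv H (h * l - r) ≤ halfPowDeriv H (h * l) := hm (by simp)
  have hr : 0 ≤ halfPowDeriv H r := by rw [← hd0]; exact hm r.2
  have hl : 0 ≤ halfPowDeriv H (h * l) := by rw [← hd0]; exact hm (by positivity)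
  rw [halfPowDeriv_neg] at b2
  simp only [neg_zero, hd0, sub_zero] at a2
  have b2' := b2.trans (mul_le_mul_of_nonneg_left (show _ ≤ halfPowDeriv H (h * l) +
    halfPowDeriv H r by linarith) hh)
  have c1 := mul_nonneg hh hr
  have c2 := mul_nonneg hh hl
  simp only [sub_zero] at a1 ⊢
  rw [abs_le]
  constructor <;> nlinarith

section
variable {Ω : Type*} [MeasurableSpace Ω] {P : Measure Ω} {B : ℝ≥0 → Ω → ℝ}

lemma IsFractionalBrownian.integral_mul (hB : IsFractionalBrownian H B P) (s t : ℝ≥0) :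
    ∫ ω, B s ω * B t ω ∂P = fbmCov H s t := by
  rw [hB.covariance_eq, fbmCov, halfPow, halfPow, halfPow, abs_of_nonneg s.coe_nonneg, abs_of_nonneg t.coe_nonneg,
    abs_sub_comm]
  ring

/-- The joint covariance of sums of summands of the Lévy area and of values of the process. -/
noncomputable def areaJointCov {κ κ' : Type*} (H h a : ℝ) (S : κ → Finset ℕ) (τ : κ' → ℝ≥0) :
    κ ⊕ κ' → κ ⊕ κ' → ℝ :=
  Sum.elim
    (fun k => Sum.elim
      (fun l => a * (a * ∑ i ∈ S k, ∑ j ∈ S l, h * (h * (h ^ (2 * H) * areaCov H (i - j)))))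
      fun r => a * ∑ i ∈ S k, crossCov H h i (τ r))
    fun r => Sum.elim (fun l => a * ∑ i ∈ S l, crossCov H h i (τ r)) fun q => fbmCov H (τ r) (τ q)

/-- `Z` is prescribed only along continuous paths, which suffices almost surely. Arbitrary index
sets S serve both for values of z_n and for its increments. -/
lemma IsFractionalBrownian.isCenteredGaussian_area [IsProbabilityMeasure P] {κ κ' : Type*}
    [Fintype κ] [Fintype κ'] (hB : IsFractionalBrownian H B P) (hH : 1 / 2 < H) {h : ℝ}
    (hh : 0 ≤ h) (a : ℝ) (S : κ → Finset ℕ) (τ : κ' → ℝ≥0) {Z : κ → Ω → ℝ}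
    (hZ : ∀ k ω, Continuous (fun t => B t ω) →
      Z k ω = a * ∑ i ∈ S k, h * trapezoidError fun u => B (gridPoint h i u) ω) :
    IsCenteredGaussian (Sum.elim Z fun r => B (τ r)) (areaJointCov H h a S τ) P := by
  have hcov := continuous_fbmCov hH
  refine isCenteredGaussian_of_tendsto hB.isGaussianProcess hB.mean_eq_zero hB.integral_mul
    (c := fun N => Sum.elim (fun k => a • ∑ i ∈ S k, areaRule h N i) fun r =>
      Finsupp.single (τ r) 1) ?_ ?_
  · rintro (k | r)
    · filter_upwards [hB.continuous_paths] with ω hω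
      simp only [Sum.elim_inl, map_smul, map_sum, smul_eq_mul, hZ k ω hω]
      exact (tendsto_finsetSum _ fun i _ =>
        tendsto_linearCombination_areaRule h i hω).const_mul a
    · simp
  · rintro (k | r) (l | q)
    · simp only [Sum.elim_inl, areaJointCov, map_smul, map_sum, smul_eq_mul, LinearMap.smul_apply,
        LinearMap.sum_apply]
      have := ((tendsto_finsetSum (S k) fun i _ => tendsto_finsetSum (S l) fun j _ =>
        tendsto_covForm_areaRule hH hh i j).const_mul a).const_mul a
      refine this.congr fun N => ?_
      rw [Finset.sum_comm, Finset.mul_sum]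
    · simp only [Sum.elim_inl, Sum.elim_inr, areaJointCov, map_smul, map_sum, smul_eq_mul,
        LinearMap.smul_apply, LinearMap.sum_apply, covForm_apply, Finsupp.linearCombination_single,
        one_mul]
      refine (tendsto_finsetSum _ fun i _ => ?_).const_mul a
      simp only [fun i => fbmCov_comm (H := H) i (τ q)]
      exact tendsto_linearCombination_areaRule h i (f := fun x => fbmCov H (τ q) x)
        (hcov.comp (by fun_prop : Continuous fun x : ℝ≥0 => (τ q, x)))
    · simp only [Sum.elim_inl, Sum.elim_inr, areaJointCov, map_smul, map_sum, smul_eq_mul,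
        covForm_apply, Finsupp.linearCombination_single, one_mul]
      exact (tendsto_finsetSum _ fun i _ =>
        tendsto_linearCombination_areaRule h i (f := fun x => fbmCov H (τ r) x)
        (hcov.comp (by fun_prop : Continuous fun x : ℝ≥0 => (τ r, x)))).const_mul a
    · simp [areaJointCov, covForm_apply]

/-! ### Sign of ϱ and the second moment bound -/

lemma IsFractionalBrownian.varrho_nonneg [IsProbabilityMeasure P]
    (hB : IsFractionalBrownian H B P) (hH : 1 / 2 < H) (hH1 : H < 1) : 0 ≤ varrho H := by
  have h1 : Tendsto (fun n : ℕ => (n : ℝ) / n) atTop (𝓝 1) :=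
    tendsto_const_nhds.congr' (by
      filter_upwards [eventually_gt_atTop 0] with n hn
      rw [div_self (by exact_mod_cast hn.ne')])
  have h2 := tendsto_sum_sum_sub (summable_areaCov hH hH1) (l := id) (m := id) h1 h1
  rw [tsum_areaCov hH hH1, min_self, one_mul] at h2
  have h3 : 0 ≤ 2 * varrho H := ge_of_tendsto' h2 fun n => by
    -- The double sum is the variance of the first n summands at mesh one; `Fin 0` discards the
    -- values of B.
    have := (hB.isCenteredGaussian_area hH zero_le_one 1 (fun _ : Unit => Finset.range n)
      (Fin.elim0 : Fin 0 → ℝ≥0) fun _ _ _ => rfl).cov_nonneg fun _ => 1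
    simp [areaJointCov] at this
    simp only [id]
    positivity
  linarith

omit [MeasurableSpace Ω] in
lemma zArea_eq (T : ℝ≥0) (n : ℕ) (t : ℝ≥0) {ω : Ω} (hω : Continuous fun t => B t ω) :
    zArea T B n t ω = ∑ k ∈ Finset.range (⌊(n : ℝ≥0) * t / T⌋₊ + 1),
      (T / n : ℝ) * trapezoidError fun u => B (gridPoint (T / n) k u) ω :=
  levyArea_id_eq hω T n t

lemma rpow_mul_mesh_rpow {n : ℕ} (hn : 1 ≤ n) (T : ℝ≥0) (x : ℝ) :
    (n : ℝ) ^ (2 * H + 1) * ((T / n : ℝ) * ((T / n : ℝ) * ((T / n : ℝ) ^ (2 * H) * x))) =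
      (T : ℝ) * T * T ^ (2 * H) * (x / n) := by
  have hn0 : (0 : ℝ) < n := by exact_mod_cast hn
  rw [Real.div_rpow T.coe_nonneg hn0.le, Real.rpow_add_one hn0.ne']
  have := (Real.rpow_pos_of_pos hn0 (2 * H)).ne'
  field_simp

lemma floor_mul_partitionPoint {T : ℝ≥0} (hT : 0 < T) {n : ℕ} (hn : 1 ≤ n) (j : ℕ) :
    ⌊(n : ℝ≥0) * partitionPoint T n j / T⌋₊ = j := by
  have hn0 : (n : ℝ≥0) ≠ 0 := by exact_mod_cast (by omega : n ≠ 0)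
  have : (n : ℝ≥0) * partitionPoint T n j / T = j := by
    rw [partitionPoint]; field_simp [hT.ne']
  rw [this, Nat.floor_natCast]

/-- Each of the j - i rows of the covariance matrix sums to at most ∑|γ|, and (j - i)T/n is the
distance of the two points. -/
lemma IsFractionalBrownian.second_moment_zArea_le [IsProbabilityMeasure P]
    (hB : IsFractionalBrownian H B P) (hH : 1 / 2 < H) (hH1 : H < 1) {T : ℝ≥0} (hT : 0 < T)
    {n : ℕ} (hn : 1 ≤ n) (i j : ℕ) :
    MemLp (fun ω => zArea T B n (partitionPoint T n j) ω - zArea T B n (partitionPoint T n i) ω)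
        2 P ∧
      (n : ℝ) ^ (2 * H + 1) * ∫ ω, (zArea T B n (partitionPoint T n j) ω -
        zArea T B n (partitionPoint T n i) ω) ^ 2 ∂P ≤
      (T : ℝ) * T ^ (2 * H) * (∑' p, |areaCov H p|) *
        |(partitionPoint T n j : ℝ) - partitionPoint T n i| := by
  wlog hij : i ≤ j generalizing i j
  · obtain ⟨h1, h2⟩ := this j i (by omega)
    refine ⟨?_, ?_⟩
    · simpa only [Pi.neg_def, neg_sub] using h1.neg
    · rw [abs_sub_comm]
      simp_rw [fun ω => sub_sq_comm (zArea T B n (partitionPoint T n j) ω)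
        (zArea T B n (partitionPoint T n i) ω)]
      exact h2
  have h := hB.isCenteredGaussian_area hH (h := T / n) (by positivity) 1
    -- The value at t_i already includes the summand k = i, so the increment runs over k = i+1, …,
    -- j.
    (fun _ : Unit => Finset.Ico (i + 1) (j + 1)) (Fin.elim0 : Fin 0 → ℝ≥0)
    (Z := fun _ ω => zArea T B n (partitionPoint T n j) ω - zArea T B n (partitionPoint T n i) ω)
    fun _ ω hω => by
      rw [zArea_eq T n _ hω, zArea_eq T n _ hω, floor_mul_partitionPoint hT hn,
        floor_mul_partitionPoint hT hn, one_mul, Finset.sum_Ico_eq_sub _ (by omega)]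
  have h1 := h.memLp_two fun _ => 1
  have h2 := h.integral_sq fun _ => 1
  simp only [Fintype.sum_sum_type, Finset.univ_unique, Finset.sum_singleton, Sum.elim_inl,
    Finset.univ_eq_empty, Finset.sum_empty, add_zero, one_mul, areaJointCov] at h1 h2
  refine ⟨h1, ?_⟩
  rw [h2]
  simp only [← Finset.mul_sum]
  rw [rpow_mul_mesh_rpow hn]
  have hn0 : (0 : ℝ) < n := by exact_mod_cast hn
  have hle := sum_sum_sub_le (summable_areaCov hH hH1) (Finset.Ico (i + 1) (j + 1))
  have hcard : ((Finset.Ico (i + 1) (j + 1)).card : ℝ) = j - i := by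
    rw [Nat.card_Ico, Nat.add_sub_add_right, Nat.cast_sub hij]
  have hdist : |(partitionPoint T n j : ℝ) - partitionPoint T n i| = (j - i) * T / n := by
    have hji : (0 : ℝ) ≤ j - i := sub_nonneg.2 (by exact_mod_cast hij)
    have : (partitionPoint T n j : ℝ) - partitionPoint T n i = (j - i) * T / n := by
      simp only [partitionPoint]; push_cast; ring
    rw [this, abs_of_nonneg (by positivity)]
  rw [hcard] at hle
  rw [hdist]
  calc _ ≤ (T : ℝ) * T * T ^ (2 * H) * ((((j : ℝ) - i) * ∑' p, |areaCov H p|) / n) := by gcongr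
    _ = _ := by ring

end

/-! ### Limits of the covariances and the weak limit -/

/-- The number `⌊n t / T⌋ + 1` of summands in `zArea T B n t`. -/
noncomputable def areaIndex (T : ℝ≥0) (n : ℕ) (t : ℝ≥0) : ℕ := ⌊(n : ℝ≥0) * t / T⌋₊ + 1

lemma tendsto_areaIndex_div (T t : ℝ≥0) :
    Tendsto (fun n : ℕ => (areaIndex T n t : ℝ) / n) atTop (𝓝 (t / T)) := by
  have h1 := (tendsto_nat_floor_mul_div_atTop (R := ℝ) (a := (t / T : ℝ)) (by positivity)).comp
    tendsto_natCast_atTop_atTop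
  have h2 : Tendsto (fun n : ℕ => (1 : ℝ) / n) atTop (𝓝 0) := tendsto_const_div_atTop_nhds_zero_nat 1
  have h3 := h1.add h2
  rw [add_zero] at h3
  refine h3.congr fun n => ?_
  have : ⌊(t / T * n : ℝ)⌋₊ = ⌊(n : ℝ≥0) * t / T⌋₊ := by
    have h4 : ⌊(((n : ℝ≥0) * t / T : ℝ≥0) : ℝ)⌋₊ = ⌊(n : ℝ≥0) * t / T⌋₊ :=
      Nonneg.nat_floor_coe (α := ℝ) _
    rw [← h4]; push_cast; ring_nf
  simp only [Function.comp_apply, this, areaIndex]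
  push_cast
  ring

lemma mesh_mul_areaIndex_le {T : ℝ≥0} (hT : 0 < T) {n : ℕ} (hn : 1 ≤ n) {t : ℝ≥0} (ht : t ≤ T) :
    (T / n : ℝ) * areaIndex T n t ≤ 2 * T := by
  have hn1 : (1 : ℝ) ≤ n := by exact_mod_cast hn
  have h1 : ⌊(n : ℝ≥0) * t / T⌋₊ ≤ n := by
    refine Nat.floor_le_of_le ?_
    rw [div_le_iff₀ hT]
    gcongr
  have h2 : (areaIndex T n t : ℝ) ≤ 2 * n := by
    have : (⌊(n : ℝ≥0) * t / T⌋₊ : ℝ) ≤ n := by exact_mod_cast h1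
    rw [areaIndex]; push_cast; linarith
  calc (T / n : ℝ) * areaIndex T n t ≤ T / n * (2 * n) := by gcongr
    _ = 2 * T := by field_simp

/-- Up to time 2T, which covers the extra summand beyond t, the cross covariance is O(n⁻²), leaving
n^{H - 3/2} → 0. -/
lemma tendsto_scaled_crossCov (hH : 1 / 2 < H) (hH1 : H < 1) {T : ℝ≥0} (hT : 0 < T) {t : ℝ≥0}
    (ht : t ≤ T) (r : ℝ≥0) :
    Tendsto (fun n : ℕ => (n : ℝ) ^ (H + 1 / 2) *
      ∑ k ∈ Finset.range (areaIndex T n t), crossCov H (T / n) k r) atTop (𝓝 0) := by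
  set M : ℝ := T * (T * (2 * halfPowDeriv H (2 * T) + halfPowDeriv H r)) with hM
  have h0 : Tendsto (fun n : ℕ => M * (n : ℝ) ^ (-(3 / 2 - H))) atTop (𝓝 0) := by
    simpa using ((tendsto_rpow_neg_atTop (by linarith : 0 < 3 / 2 - H)).comp
      tendsto_natCast_atTop_atTop).const_mul M
  refine squeeze_zero_norm' ?_ h0
  filter_upwards [eventually_ge_atTop 1] with n hn
  have hn0 : (0 : ℝ) < n := by exact_mod_cast hn
  have h1 := abs_sum_crossCov_le hH (h := (T / n : ℝ)) (by positivity) (areaIndex T n t) r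
  have h2 := monotone_halfPowDeriv hH (mesh_mul_areaIndex_le hT hn ht)
  rw [norm_mul, Real.norm_eq_abs, Real.norm_eq_abs, abs_of_nonneg (by positivity)]
  calc (n : ℝ) ^ (H + 1 / 2) * |∑ k ∈ Finset.range (areaIndex T n t), crossCov H (T / n) k r|
      ≤ (n : ℝ) ^ (H + 1 / 2) *
        (T / n * (T / n * (2 * halfPowDeriv H (2 * T) + halfPowDeriv H r))) := by
        gcongr
        refine h1.trans ?_
        gcongr
    _ = M * (n : ℝ) ^ (-(3 / 2 - H)) := by
      rw [show -(3 / 2 - H) = H + 1 / 2 - 2 by ring, Real.rpow_sub hn0, hM, Real.rpow_two]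
      field_simp

lemma tendsto_scaled_areaCov (hH : 1 / 2 < H) (hH1 : H < 1) {T : ℝ≥0} (hT : 0 < T)
    (hϱ : 0 ≤ varrho H) (t s : ℝ≥0) :
    Tendsto (fun n : ℕ => (n : ℝ) ^ (H + 1 / 2) * ((n : ℝ) ^ (H + 1 / 2) *
      ∑ i ∈ Finset.range (areaIndex T n t), ∑ j ∈ Finset.range (areaIndex T n s),
        (T / n : ℝ) * ((T / n : ℝ) * ((T / n : ℝ) ^ (2 * H) * areaCov H (i - j))))) atTop
      (𝓝 (√(2 * varrho H) * (T : ℝ) ^ (H + 1 / 2) * (√(2 * varrho H) * (T : ℝ) ^ (H + 1 / 2)) *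
        (min t s : ℝ≥0))) := by
  have hT0 : (0 : ℝ) < T := hT
  have h := (tendsto_sum_sum_sub (summable_areaCov hH hH1) (tendsto_areaIndex_div T t)
    (tendsto_areaIndex_div T s)).const_mul ((T : ℝ) * T * T ^ (2 * H))
  -- T^{2H+2}·(min(t,s)/T)·2ϱ is rewritten as σ²·min(t,s); ϱ ≥ 0 is needed for the square root.
  have e : (T : ℝ) * T * T ^ (2 * H) * (min (t / T : ℝ) (s / T) * ∑' p, areaCov H p) =
      √(2 * varrho H) * (T : ℝ) ^ (H + 1 / 2) * (√(2 * varrho H) * (T : ℝ) ^ (H + 1 / 2)) *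
        (min t s : ℝ≥0) := by
    have h1 : √(2 * varrho H) * √(2 * varrho H) = 2 * varrho H :=
      Real.mul_self_sqrt (by linarith)
    have h2 : (T : ℝ) ^ (H + 1 / 2) * (T : ℝ) ^ (H + 1 / 2) = T * T ^ (2 * H) := by
      rw [← Real.rpow_add hT0, show H + 1 / 2 + (H + 1 / 2) = 2 * H + 1 by ring,
        Real.rpow_add_one hT0.ne']
      ring
    rw [tsum_areaCov hH hH1, min_div_div_right hT0.le,
      mul_mul_mul_comm (√(2 * varrho H)), h1, h2]
    push_cast
    field_simp
  rw [e] at h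
  refine h.congr' ?_
  filter_upwards [eventually_ge_atTop 1] with n hn
  have hn0 : (0 : ℝ) < n := by exact_mod_cast hn
  rw [← rpow_mul_mesh_rpow hn, ← mul_assoc ((n : ℝ) ^ (H + 1 / 2)), ← Real.rpow_add hn0]
  simp only [← Finset.mul_sum]
  ring_nf

lemma IsFractionalBrownian.tendstoInDistribution_zArea {Ω Ω' : Type*} [MeasurableSpace Ω]
    [MeasurableSpace Ω'] {P : Measure Ω} [IsProbabilityMeasure P] {P' : Measure Ω'}
    [IsProbabilityMeasure P'] {B : ℝ≥0 → Ω → ℝ} {W B' : ℝ≥0 → Ω' → ℝ}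
    (hB : IsFractionalBrownian H B P) (hH : 1 / 2 < H) (hH1 : H < 1) {T : ℝ≥0} (hT : 0 < T)
    (hW : IsBrownianReal W P') (hB' : IsFractionalBrownian H B' P')
    (hWB : IndepFun (fun ω r => W r ω) (fun ω r => B' r ω) P') (I : Finset ℝ≥0)
    (hI : ∀ r ∈ I, r ≤ T) :
    TendstoInDistribution
      (fun (n : ℕ) (ω : Ω) (r : I) => ((n : ℝ) ^ (H + 1 / 2) * zArea T B n r ω, B r ω)) atTop
      (fun (ω : Ω') (r : I) => (√(2 * varrho H) * (T : ℝ) ^ (H + 1 / 2) * W r ω, B' r ω))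
      (fun _ => P) P' := by
  set σ : ℝ := √(2 * varrho H) * (T : ℝ) ^ (H + 1 / 2) with hσ
  have hϱ := hB.varrho_nonneg hH hH1
  have hX (n : ℕ) := hB.isCenteredGaussian_area hH (h := (T / n : ℝ)) (by positivity)
    ((n : ℝ) ^ (H + 1 / 2)) (fun r : I => Finset.range (areaIndex T n r)) (fun r : I => (r : ℝ≥0))
    (Z := fun r ω => (n : ℝ) ^ (H + 1 / 2) * zArea T B n r ω) fun r ω hω => by
      rw [zArea_eq T n _ hω, areaIndex]
  have hWc := isCenteredGaussian_of_isGaussianProcess hW.isGaussianProcess hW.integral_eval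
    (R := fun s t => (min s t : ℝ≥0)) (fun s t => by
      have h := hW.covariance_eval s t
      rw [covariance_eq_sub (hW.isGaussianProcess.hasGaussianLaw_eval s).memLp_two
        (hW.isGaussianProcess.hasGaussianLaw_eval t).memLp_two, hW.integral_eval,
        zero_mul, sub_zero] at h
      simpa using h) (fun _ : I => σ) (fun r : I => (r : ℝ≥0))
  have hBc := isCenteredGaussian_of_isGaussianProcess hB'.isGaussianProcess hB'.mean_eq_zero
    hB'.integral_mul (fun _ : I => 1) (fun r : I => (r : ℝ≥0))
  have hind : IndepFun (fun ω (r : I) => σ * W r ω) (fun ω (r : I) => 1 * B' r ω) P' :=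
    hWB.comp (φ := fun (w : ℝ≥0 → ℝ) (r : I) => σ * w r)
      (ψ := fun (w : ℝ≥0 → ℝ) (r : I) => 1 * w r) (by fun_prop)
      (by fun_prop)
  -- The limit covariance is block diagonal; the four cases are its blocks, and the B-B block does
  -- not depend on n.
  have hlim := tendstoInDistribution_of_isCenteredGaussian hX (hWc.sumElim hBc hind) (by
    rintro (t | t) (s | s)
    · exact tendsto_scaled_areaCov hH hH1 hT hϱ t s
    · exact tendsto_scaled_crossCov hH hH1 hT (hI t t.2) s
    · exact tendsto_scaled_crossCov hH hH1 hT (hI s s.2) t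
    · simp [areaJointCov])
  have h := hlim.continuous_comp (g := fun (x : I ⊕ I → ℝ) (r : I) => (x (.inl r), x (.inr r)))
    (by fun_prop)
  simpa [Function.comp_def] using h

end

theorem proposition3p2 (H : ℝ) (hH : 1 / 2 < H) (hH1 : H < 1) (T : ℝ≥0) (hT : 0 < T) :
    -- the series defining `ϱ` converges absolutely
    Summable (fun p : ℤ => tildeQ H p - tildeR H p) ∧
    -- second moment bound on the partition, with a constant depending only on `H` and `T`
    (∃ K : ℝ, ∀ (Ω : Type*) [MeasurableSpace Ω] (P : Measure Ω) [IsProbabilityMeasure P]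
      (B : ℝ≥0 → Ω → ℝ), IsFractionalBrownian H B P →
      ∀ n : ℕ, 1 ≤ n → ∀ s t : ℝ≥0,
        (∃ i ≤ n, s = partitionPoint T n i) → (∃ j ≤ n, t = partitionPoint T n j) →
        MemLp (fun ω => zArea T B n t ω - zArea T B n s ω) 2 P ∧
        (n : ℝ) ^ (2 * H + 1) * ∫ ω, (zArea T B n t ω - zArea T B n s ω) ^ 2 ∂P
          ≤ K * |(t : ℝ) - (s : ℝ)|) ∧
    -- convergence of the finite-dimensional distributions on `[0, T]`; the limit `(W, B')`
    -- lives on any probability space, `B'` having the law of `B`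
    (∀ (Ω : Type*) [MeasurableSpace Ω] (P : Measure Ω) [IsProbabilityMeasure P]
      (B : ℝ≥0 → Ω → ℝ), IsFractionalBrownian H B P →
      0 ≤ varrho H ∧
      ∀ (Ω' : Type*) [MeasurableSpace Ω'] (P' : Measure Ω') [IsProbabilityMeasure P']
        (W B' : ℝ≥0 → Ω' → ℝ), IsBrownianReal W P' → IsFractionalBrownian H B' P' →
        IndepFun (fun ω r => W r ω) (fun ω r => B' r ω) P' →
        ∀ I : Finset ℝ≥0, (∀ r ∈ I, r ≤ T) →
          TendstoInDistribution
            (fun (n : ℕ) (ω : Ω) (r : I) =>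
              ((n : ℝ) ^ (H + 1 / 2) * zArea T B n r ω, B r ω))
            atTop
            (fun (ω : Ω') (r : I) =>
              (√(2 * varrho H) * (T : ℝ) ^ (H + 1 / 2) * W r ω, B' r ω))
            (fun _ => P) P') := by
  refine ⟨summable_tildeQ_sub_tildeR hH hH1, ⟨T * T ^ (2 * H) * ∑' p, |areaCov H p|, ?_⟩, ?_⟩
  · rintro Ω _ P _ B hB n hn s t ⟨i, -, rfl⟩ ⟨j, -, rfl⟩
    exact hB.second_moment_zArea_le hH hH1 hT hn i j
  · intro Ω _ P _ B hB
    exact ⟨hB.varrho_nonneg hH hH1, fun Ω' _ P' _ W B' hW hB' hWB I hI =>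
      hB.tendstoInDistribution_zArea hH hH1 hT hW hB' hWB I hI⟩
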